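/- Let $B\in\mathbb R^{n}$, let $x(0),\dots,x(T)\in\mathbb R^n$ and $u(0),\dots,u(T-1)\in\mathbb R$ be data of an unknown system, $x(k+1)=A_0x(k)+Bu(k)+w(k)$ for $0\le k<T$, whose noise matrix $W=[w(0)\ \cdots\ w(T-1)]$ satisfies $$\begin{bmatrix} I\\ W^\top\end{bmatrix}^\top\Phi\begin{bmatrix} I\\ W^\top\end{bmatrix}\ge 0,\qquad \Phi=\begin{bmatrix}\Phi_{11}&\Phi_{12}\\ \Phi_{12}^\top&\Phi_{22}\end{bmatrix},$$ with $\Phi_{11}$ symmetric and $\Phi_{22}$ symmetric negative definite. Put $X_-=[x(0)\ \cdots\ x(T-1)]$, $X_+=[x(1)\ \cdots\ x(T)]$, $U=[u(0)\ \cdots\ u(T-1)]$, $X_U=X_+-BU$, and let $\Sigma$ be the set of all $A\in\mathbb R^{n\times n}$ consistent with the data: $$\Sigma=\left\{A:\ \begin{bmatrix} I\\ A^\top\end{bmatrix}^\top\begin{bmatrix} I&X_U\\0&-X_-\end{bmatrix}\Phi\begin{bmatrix} I&X_U\\0&-X_-\end{bmatrix}^\top\begin{bmatrix} I\\ A^\top\end{bmatrix}\ge0\right\}.$$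 For a gain $K\in\mathbb R^{1\times n}$ let $G_{A,K}(z)=K(zI-A-BK)^{-1}B$, and let $\|G_{A,K}\|_\infty=\sup_{|z|=1}|G_{A,K}(z)|$ if all eigenvalues of $A+BK$ lie in the open unit disc, $\|G_{A,K}\|_\infty=\infty$ otherwise. Let $$\gamma^*=\inf_{K}\ \sup_{A\in\Sigma}\ \|G_{A,K}\|_\infty .$$ Let $0<\delta<1$, $\rho=(1-\delta)/(1+\delta)$ and $u_0>0$. The logarithmic quantizer $f$ of density $\rho$ has levels $u_i=\rho^{-i}u_0$, $i\in\mathbb Z$, and is given by $f(v)=u_i$ for $\frac{u_i}{1+\delta}<v\le\frac{u_i}{1-\delta}$, $f(0)=0$, and $f(v)=-f(-v)$ for $v<0$. The quantized controller $u(k)=f(Kx(k))$ is said to stabilize $A$ if the noise-free closed loop $x\mapsto x^+=Ax+Bf(Kx)$ is quadratically stable, that is, there are a positive definite $P$ and $\varepsilon>0$ with $(x^+)^\top Px^+\le x^\top Px-\varepsilon|x|^2$ for all $x\in\mathbb R^n$. Suppose that the min-max problem is feasible, i.e. $\sup_{A\in\Sigma}\|G_{A,K}\|_\infty<\infty$ for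 some $K$. Then there is a gain $K$ for which the logarithmically quantized controller of density $\rho=(1-\delta)/(1+\delta)$ stabilizes every $A\in\Sigma$ if and only if $\delta<1/\gamma^*$ (with $1/0=\infty$). -/

import Mathlib

open scoped ENNReal Matrix

noncomputable section

namespace QuantizedStabilization

/-! ### The logarithmic quantizer -/

/-- The sector bound `δ = (1 - ρ) / (1 + ρ)` of a logarithmic quantizer with density `ρ`. -/
def sectorBound (ρ : ℝ) : ℝ := (1 - ρ) / (1 + ρ)

/-- The quantization levels `u_i = ρ ^ (-i) * u₀`, for `i` an integer. -/
def level (ρ u₀ : ℝ) (i : ℤ) : ℝ := ρ ^ (-i) * u₀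

/-- `v` lies in the cell `(u_i / (1 + δ), u_i / (1 - δ)]` of the level `u_i`. -/
def InCell (ρ u₀ : ℝ) (i : ℤ) (v : ℝ) : Prop :=
  1 / (1 + sectorBound ρ) * level ρ u₀ i < v ∧ v ≤ 1 / (1 - sectorBound ρ) * level ρ u₀ i

open Classical in
/-- The quantizer on positive reals: `u_i` for `v` in the cell of `u_i`. (For `0 < ρ < 1` and
`0 < u₀` every positive `v` lies in exactly one cell.) -/
def posQuantizer (ρ u₀ v : ℝ) : ℝ :=
  if h : ∃ i : ℤ, InCell ρ u₀ i v then level ρ u₀ h.choose else 0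

/-- The logarithmic quantizer with density `ρ` and base level `u₀`: the odd extension of
`posQuantizer`, with value `0` at `0`. -/
def logQuantizer (ρ u₀ v : ℝ) : ℝ :=
  if 0 < v then posQuantizer ρ u₀ v
  else if v < 0 then -posQuantizer ρ u₀ (-v)
  else 0

/-! ### Quantized closed loops and their stability -/

/-- One step `x ↦ A x + B f(K x)` of the (noise-free) system under the quantized linear state
feedback with gain `K` and the logarithmic quantizer `f` of density `ρ`. -/
def closedLoopStep {n : ℕ} (A : Matrix (Fin n) (Fin n) ℝ) (B K : Fin n → ℝ) (ρ u₀ : ℝ)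
    (x : Fin n → ℝ) : Fin n → ℝ :=
  A *ᵥ x + logQuantizer ρ u₀ (K ⬝ᵥ x) • B

/-- The quantized controller with gain `K` and density `ρ` (quadratically) stabilizes `(A, B)`:
some quadratic Lyapunov function `V(x) = xᵀ P x`, `P > 0`, decreases along the quantized closed
loop by at least `ε |x|²`, for some `ε > 0`. -/
def Stabilizes {n : ℕ} (A : Matrix (Fin n) (Fin n) ℝ) (B K : Fin n → ℝ) (ρ u₀ : ℝ) : Prop :=
  ∃ P : Matrix (Fin n) (Fin n) ℝ, P.PosDef ∧ ∃ ε : ℝ, 0 < ε ∧ ∀ x : Fin n → ℝ,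
    closedLoopStep A B K ρ u₀ x ⬝ᵥ (P *ᵥ closedLoopStep A B K ρ u₀ x)
      ≤ x ⬝ᵥ (P *ᵥ x) - ε * (x ⬝ᵥ x)

/-! ### Data and the uncertainty set -/

/-- `X₋ = [x(0) ⋯ x(T-1)]`. -/
def dataPast {n T : ℕ} (x : Fin (T + 1) → Fin n → ℝ) : Matrix (Fin n) (Fin T) ℝ :=
  Matrix.of fun i k => x k.castSucc i

/-- `X₊ = [x(1) ⋯ x(T)]`. -/
def dataFuture {n T : ℕ} (x : Fin (T + 1) → Fin n → ℝ) : Matrix (Fin n) (Fin T) ℝ :=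
  Matrix.of fun i k => x k.succ i

/-- The noise matrix `W = [w(0) ⋯ w(T-1)]`. -/
def noiseMatrix {n T : ℕ} (w : Fin T → Fin n → ℝ) : Matrix (Fin n) (Fin T) ℝ :=
  Matrix.of fun i k => w k i

/-- `X_U = X₊ - B U`, with `U = [u(0) ⋯ u(T-1)]`. -/
def dataXU {n T : ℕ} (B : Fin n → ℝ) (x : Fin (T + 1) → Fin n → ℝ) (u : Fin T → ℝ) :
    Matrix (Fin n) (Fin T) ℝ :=
  dataFuture x - Matrix.vecMulVec B u

/-- The quadratic noise bound `[I; Wᵀ]ᵀ [Φ₁₁ Φ₁₂; Φ₁₂ᵀ Φ₂₂] [I; Wᵀ] ≥ 0`. -/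
def NoiseBound {n T : ℕ} (Φ₁₁ : Matrix (Fin n) (Fin n) ℝ) (Φ₁₂ : Matrix (Fin n) (Fin T) ℝ)
    (Φ₂₂ : Matrix (Fin T) (Fin T) ℝ) (W : Matrix (Fin n) (Fin T) ℝ) : Prop :=
  ((Matrix.fromRows (1 : Matrix (Fin n) (Fin n) ℝ) Wᵀ)ᵀ *
    Matrix.fromBlocks Φ₁₁ Φ₁₂ Φ₁₂ᵀ Φ₂₂ *
    Matrix.fromRows (1 : Matrix (Fin n) (Fin n) ℝ) Wᵀ).PosSemidef

/-- The block matrix `[I X_U; 0 -X₋]`. -/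
def dataBlock {n T : ℕ} (B : Fin n → ℝ) (x : Fin (T + 1) → Fin n → ℝ) (u : Fin T → ℝ) :
    Matrix (Fin n ⊕ Fin n) (Fin n ⊕ Fin T) ℝ :=
  Matrix.fromBlocks 1 (dataXU B x u) 0 (-(dataPast x))

/-- The set `Σ` of all state matrices that are consistent with the data and the noise bound. -/
def uncertaintySet {n T : ℕ} (B : Fin n → ℝ) (x : Fin (T + 1) → Fin n → ℝ) (u : Fin T → ℝ)
    (Φ₁₁ : Matrix (Fin n) (Fin n) ℝ) (Φ₁₂ : Matrix (Fin n) (Fin T) ℝ)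
    (Φ₂₂ : Matrix (Fin T) (Fin T) ℝ) : Set (Matrix (Fin n) (Fin n) ℝ) :=
  {A | ((Matrix.fromRows (1 : Matrix (Fin n) (Fin n) ℝ) Aᵀ)ᵀ *
      (dataBlock B x u * Matrix.fromBlocks Φ₁₁ Φ₁₂ Φ₁₂ᵀ Φ₂₂ * (dataBlock B x u)ᵀ) *
      Matrix.fromRows (1 : Matrix (Fin n) (Fin n) ℝ) Aᵀ).PosSemidef}

/-! ### The `H∞` problem -/

/-- The closed-loop matrix `A + B K`. -/
def closedLoop {n : ℕ} (A : Matrix (Fin n) (Fin n) ℝ) (B K : Fin n → ℝ) :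
    Matrix (Fin n) (Fin n) ℝ :=
  A + Matrix.vecMulVec B K

/-- Schur stability: all complex eigenvalues lie in the open unit disc. -/
def IsSchur {n : ℕ} (M : Matrix (Fin n) (Fin n) ℝ) : Prop :=
  ∀ z ∈ spectrum ℂ (M.map Complex.ofReal), ‖z‖ < 1

/-- The transfer function `G_{A,K}(z) = K (z I - A - B K)⁻¹ B`. -/
def transferFn {n : ℕ} (A : Matrix (Fin n) (Fin n) ℝ) (B K : Fin n → ℝ) (z : ℂ) : ℂ :=
  (fun i => (K i : ℂ)) ⬝ᵥ
    ((z • (1 : Matrix (Fin n) (Fin n) ℂ) - (closedLoop A B K).map Complex.ofReal)⁻¹ *ᵥ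
      fun i => (B i : ℂ))

open Classical in
/-- The `H∞` norm of the system `(A + B K, B, K, 0)`: the supremum of `|G_{A,K}|` over the unit
circle if the closed loop is internally stable, and `∞` otherwise. -/
def hInfNorm {n : ℕ} (A : Matrix (Fin n) (Fin n) ℝ) (B K : Fin n → ℝ) : ℝ≥0∞ :=
  if IsSchur (closedLoop A B K) then ⨆ (z : ℂ) (_ : ‖z‖ = 1), ‖transferFn A B K z‖ₑ else ∞

/-- The worst-case norm `max_{A ∈ S} ‖G_{A,K}‖_∞` of the gain `K`. -/
def worstNorm {n : ℕ} (S : Set (Matrix (Fin n) (Fin n) ℝ)) (B K : Fin n → ℝ) : ℝ≥0∞ :=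
  ⨆ A ∈ S, hInfNorm A B K

/-- Feasibility of the min-max problem: some gain has a finite worst-case norm. -/
def MinMaxFeasible {n : ℕ} (S : Set (Matrix (Fin n) (Fin n) ℝ)) (B : Fin n → ℝ) : Prop :=
  ∃ K : Fin n → ℝ, worstNorm S B K < ∞

/-- The optimal value `γ* = min_K max_{A ∈ S} ‖G_{A,K}‖_∞`. -/
def optValue {n : ℕ} (S : Set (Matrix (Fin n) (Fin n) ℝ)) (B : Fin n → ℝ) : ℝ≥0∞ :=
  ⨅ K : Fin n → ℝ, worstNorm S B K

end QuantizedStabilization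

end

noncomputable section

namespace QuantizedStabilization

/-! ### The sector bound of the logarithmic quantizer -/

/-! Fix a plant and a gain and put M = A + BK. The quantization error w = f(v) - v satisfies |w| ≤
δ|v|, and along each ray f(v)/v takes every value in [1-δ, 1+δ). A quadratic Lyapunov inequality is
homogeneous, so quantized stability is the same as quadratic stability of x⁺ = Mx + wB under all |w|
≤ δ|Kx| (`stabilizes_iff_sectorStable`).

By the strict bounded real lemma this holds iff M is Schur and δ|G| < 1 on the unit circle. For
necessity, the Lyapunov inequality is tested on ξ = (zI - M)⁻¹B (`SectorStable.norm_transferFn_lt`).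
Sufficiency is a duality argument (`sectorStable_of_norm_transferFn_lt`): a Lyapunov matrix is a
separating functional, and the only obstruction to it would be a nonzero stationary second-moment
matrix of pairs (x, w) with ∑w² ≤ δ²∑(Kx)². Diagonalizing a unitary splits such a matrix into pure
frequencies, where δ|G| < 1 excludes it (`eq_zero_of_stationary`).

It remains to pass to the supremum over Σ. A gain with finite worst-case norm forces Σ to be compact
(`isCompact_uncertaintySet`), so the supremum over Σ and the circle is attained and stays strictly
below 1/δ. Conversely, γ* < 1/δ gives a gain whose worst-case norm is below 1/δ; the Lyapunov matrix
may depend on A. -/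

theorem sectorBound_density {δ : ℝ} (hδ₀ : 0 < δ) :
    sectorBound ((1 - δ) / (1 + δ)) = δ := by
  unfold sectorBound
  field_simp
  ring

theorem le_of_mul_level_lt_level {ρ u₀ : ℝ} (hρ : 0 < ρ) (hρ₁ : ρ < 1) (hu₀ : 0 < u₀) {i j : ℤ}
    (h : ρ * level ρ u₀ i < level ρ u₀ j) : i ≤ j := by
  unfold level at h
  rw [← mul_assoc, mul_lt_mul_iff_left₀ hu₀, mul_comm, ← zpow_add_one₀ hρ.ne',
    zpow_lt_zpow_iff_right_of_lt_one₀ hρ hρ₁] at h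
  omega

theorem inCell_iff {δ u₀ : ℝ} (hδ₀ : 0 < δ) (hδ₁ : δ < 1) (i : ℤ) (v : ℝ) :
    InCell ((1 - δ) / (1 + δ)) u₀ i v ↔
      level ((1 - δ) / (1 + δ)) u₀ i < (1 + δ) * v ∧
        (1 - δ) * v ≤ level ((1 - δ) / (1 + δ)) u₀ i := by
  have h1 : 0 < 1 - δ := by linarith
  have h2 : 0 < 1 + δ := by linarith
  unfold InCell
  rw [sectorBound_density hδ₀, one_div_mul_eq_div, one_div_mul_eq_div, div_lt_iff₀ h2,
    le_div_iff₀ h1, mul_comm v, mul_comm v]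

theorem exists_inCell {δ u₀ v : ℝ} (hδ₀ : 0 < δ) (hδ₁ : δ < 1) (hu₀ : 0 < u₀) (hv : 0 < v) :
    ∃ i : ℤ, InCell ((1 - δ) / (1 + δ)) u₀ i v := by
  have h1 : 0 < 1 - δ := by linarith
  have h2 : 0 < 1 + δ := by linarith
  have hr : 1 < (1 + δ) / (1 - δ) := by rw [lt_div_iff₀ h1]; linarith
  -- The ratio of consecutive levels is ρ⁻¹ = (1+δ)/(1-δ); multiplying the upper bound by ρ turns
  -- 1+δ into 1-δ.
  obtain ⟨i, hi, hi'⟩ := exists_mem_Ioc_zpow (x := (1 + δ) * v / u₀) (by positivity) hr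
  refine ⟨i, (inCell_iff hδ₀ hδ₁ i v).2 ?_⟩
  have hlev : level ((1 - δ) / (1 + δ)) u₀ i = ((1 + δ) / (1 - δ)) ^ i * u₀ := by
    rw [level, zpow_neg, ← inv_zpow, inv_div]
  rw [hlev]
  rw [lt_div_iff₀ hu₀] at hi
  rw [div_le_iff₀ hu₀, zpow_add_one₀ (by positivity)] at hi'
  refine ⟨hi, ?_⟩
  have : (1 + δ) * v * ((1 - δ) / (1 + δ)) ≤
      ((1 + δ) / (1 - δ)) ^ i * ((1 + δ) / (1 - δ)) * u₀ * ((1 - δ) / (1 + δ)) :=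
    mul_le_mul_of_nonneg_right hi' (by positivity)
  calc (1 - δ) * v = (1 + δ) * v * ((1 - δ) / (1 + δ)) := by field_simp
    _ ≤ _ := this
    _ = _ := by field_simp

theorem posQuantizer_mem_sector {δ u₀ v : ℝ} (hδ₀ : 0 < δ) (hδ₁ : δ < 1) (hu₀ : 0 < u₀)
    (hv : 0 < v) :
    (1 - δ) * v ≤ posQuantizer ((1 - δ) / (1 + δ)) u₀ v ∧
      posQuantizer ((1 - δ) / (1 + δ)) u₀ v ≤ (1 + δ) * v := by
  have h := exists_inCell hδ₀ hδ₁ hu₀ hv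
  rw [posQuantizer, dif_pos h]
  have := (inCell_iff hδ₀ hδ₁ _ v).1 h.choose_spec
  exact ⟨this.2, this.1.le⟩

/-- Cells are disjoint because ρ(1+δ) = 1-δ, so the index selected by `choose` is the only possible
one. -/
theorem posQuantizer_eq_level {δ u₀ v : ℝ} (hδ₀ : 0 < δ) (hδ₁ : δ < 1) (hu₀ : 0 < u₀) {i : ℤ}
    (hi : InCell ((1 - δ) / (1 + δ)) u₀ i v) :
    posQuantizer ((1 - δ) / (1 + δ)) u₀ v = level ((1 - δ) / (1 + δ)) u₀ i := by
  have h : ∃ i : ℤ, InCell ((1 - δ) / (1 + δ)) u₀ i v := ⟨i, hi⟩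
  rw [posQuantizer, dif_pos h]
  have h1 := (inCell_iff hδ₀ hδ₁ _ v).1 h.choose_spec
  have h2 := (inCell_iff hδ₀ hδ₁ _ v).1 hi
  have hp : 0 < 1 - δ := by linarith
  have hp' : 0 < 1 + δ := by linarith
  have hρ : 0 < (1 - δ) / (1 + δ) := by positivity
  have hρ₁ : (1 - δ) / (1 + δ) < 1 := by rw [div_lt_one hp']; linarith
  have key : ∀ j k : ℤ, level ((1 - δ) / (1 + δ)) u₀ j < (1 + δ) * v →
      (1 - δ) * v ≤ level ((1 - δ) / (1 + δ)) u₀ k → j ≤ k := by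
    intro j k hj hk
    refine le_of_mul_level_lt_level hρ hρ₁ hu₀ (lt_of_lt_of_le ?_ hk)
    calc (1 - δ) / (1 + δ) * level ((1 - δ) / (1 + δ)) u₀ j
        < (1 - δ) / (1 + δ) * ((1 + δ) * v) := mul_lt_mul_of_pos_left hj hρ
      _ = (1 - δ) * v := by field_simp
  rw [le_antisymm (key _ _ h1.1 h2.2) (key _ _ h2.1 h1.2)]

theorem logQuantizer_neg {ρ u₀ v : ℝ} : logQuantizer ρ u₀ (-v) = -logQuantizer ρ u₀ v := by
  unfold logQuantizer
  rcases lt_trichotomy v 0 with h | h | h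
  · simp [h, not_lt.2 h.le]
  · simp [h]
  · simp [h, not_lt.2 h.le]

theorem abs_logQuantizer_sub_le {δ u₀ v : ℝ} (hδ₀ : 0 < δ) (hδ₁ : δ < 1) (hu₀ : 0 < u₀) :
    |logQuantizer ((1 - δ) / (1 + δ)) u₀ v - v| ≤ δ * |v| := by
  have hpos : ∀ v : ℝ, 0 < v → |logQuantizer ((1 - δ) / (1 + δ)) u₀ v - v| ≤ δ * |v| := by
    intro v hv
    have := posQuantizer_mem_sector hδ₀ hδ₁ hu₀ hv
    rw [logQuantizer, if_pos hv, abs_of_pos hv, abs_le]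
    constructor <;> linarith
  rcases lt_trichotomy v 0 with h | h | h
  · have := hpos (-v) (by linarith)
    rwa [logQuantizer_neg, abs_neg, neg_sub_neg, abs_sub_comm] at this
  · simp [h, logQuantizer]
  · exact hpos v h

/-- Every point of the sector `[1 - δ, 1 + δ)` is attained by the quantizer on every ray. -/
theorem exists_scale_logQuantizer {δ u₀ v Δ : ℝ} (hδ₀ : 0 < δ) (hδ₁ : δ < 1) (hu₀ : 0 < u₀)
    (hv : v ≠ 0) (hΔ : Δ ∈ Set.Ico (-δ) δ) :
    ∃ t : ℝ, t ≠ 0 ∧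
      logQuantizer ((1 - δ) / (1 + δ)) u₀ (t * v) = (1 + Δ) * (t * v) := by
  have hΔ' : 0 < 1 + Δ := by linarith [hΔ.1]
  -- The scaled point is u₀/(1+Δ), in the cell of level 0, whose output is u₀. The cell is open on
  -- the left, which excludes Δ = δ.
  refine ⟨u₀ / (1 + Δ) / v, by positivity, ?_⟩
  rw [div_mul_cancel₀ _ hv, mul_div_cancel₀ _ hΔ'.ne']
  have hc : InCell ((1 - δ) / (1 + δ)) u₀ 0 (u₀ / (1 + Δ)) := by
    rw [inCell_iff hδ₀ hδ₁]
    simp only [level, neg_zero, zpow_zero, one_mul]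
    rw [← mul_div_assoc, ← mul_div_assoc, lt_div_iff₀ hΔ', div_le_iff₀ hΔ']
    constructor <;> nlinarith [hΔ.1, hΔ.2]
  rw [logQuantizer, if_pos (by positivity), posQuantizer_eq_level hδ₀ hδ₁ hu₀ hc]
  simp [level]

/-! ### Quadratic stability under sector bounded feedback -/

/-- Quadratic stability of `x⁺ = M x + w B` for all inputs `w` with `|w| ≤ δ |K x|`. -/
def SectorStable {n : ℕ} (M : Matrix (Fin n) (Fin n) ℝ) (B K : Fin n → ℝ) (δ : ℝ) : Prop :=
  ∃ P : Matrix (Fin n) (Fin n) ℝ, P.PosDef ∧ ∃ ε : ℝ, 0 < ε ∧ ∀ (x : Fin n → ℝ) (w : ℝ),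
    |w| ≤ δ * |K ⬝ᵥ x| →
      (M *ᵥ x + w • B) ⬝ᵥ (P *ᵥ (M *ᵥ x + w • B)) ≤ x ⬝ᵥ (P *ᵥ x) - ε * (x ⬝ᵥ x)

theorem closedLoop_mulVec {n : ℕ} (A : Matrix (Fin n) (Fin n) ℝ) (B K x : Fin n → ℝ) :
    closedLoop A B K *ᵥ x = A *ᵥ x + (K ⬝ᵥ x) • B := by
  rw [closedLoop, Matrix.add_mulVec, Matrix.vecMulVec_mulVec]
  ext i
  simp [mul_comm]

/-- Both directions keep the same P and ε. Going from the quantizer to the sector, scaling x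
realizes each ratio Δ in [-δ, δ) and the factor t² cancels. -/
theorem stabilizes_iff_sectorStable {n : ℕ} (A : Matrix (Fin n) (Fin n) ℝ) (B K : Fin n → ℝ)
    {δ u₀ : ℝ} (hδ₀ : 0 < δ) (hδ₁ : δ < 1) (hu₀ : 0 < u₀) :
    Stabilizes A B K ((1 - δ) / (1 + δ)) u₀ ↔ SectorStable (closedLoop A B K) B K δ := by
  constructor
  · rintro ⟨P, hP, ε, hε, h⟩
    refine ⟨P, hP, ε, hε, fun x w hw => ?_⟩
    by_cases hv : K ⬝ᵥ x = 0
    · have hw0 : w = 0 := by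
        rw [hv, abs_zero, mul_zero] at hw
        exact abs_nonpos_iff.1 hw
      have := h x
      simpa [closedLoopStep, hv, logQuantizer, closedLoop_mulVec, hw0] using this
    let F : ℝ → ℝ := fun Δ => (closedLoop A B K *ᵥ x + (Δ * K ⬝ᵥ x) • B) ⬝ᵥ
      (P *ᵥ (closedLoop A B K *ᵥ x + (Δ * K ⬝ᵥ x) • B))
    have hF : Continuous F := by
      unfold F
      fun_prop
    -- The endpoint Δ = δ, never attained by the quantizer, is reached by continuity.
    have hcl : Set.Icc (-δ) δ ⊆ {Δ | F Δ ≤ x ⬝ᵥ (P *ᵥ x) - ε * (x ⬝ᵥ x)} := by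
      rw [← closure_Ico (by linarith : -δ ≠ δ)]
      refine closure_minimal ?_ (isClosed_le hF continuous_const)
      intro Δ hΔ
      obtain ⟨t, ht, hq⟩ := exists_scale_logQuantizer hδ₀ hδ₁ hu₀ hv hΔ
      have := h (t • x)
      have hstep : closedLoopStep A B K ((1 - δ) / (1 + δ)) u₀ (t • x) =
          t • (closedLoop A B K *ᵥ x + (Δ * K ⬝ᵥ x) • B) := by
        rw [closedLoopStep, dotProduct_smul, smul_eq_mul, hq, closedLoop_mulVec]
        ext i
        simp [Matrix.mulVec_smul]
        ring
      rw [hstep] at this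
      simp only [Matrix.mulVec_smul, smul_dotProduct, dotProduct_smul, smul_eq_mul] at this
      have ht2 : 0 < t * t := mul_self_pos.2 ht
      refine le_of_mul_le_mul_left ?_ ht2
      simp only [F]
      linarith
    have hmem : w / (K ⬝ᵥ x) ∈ Set.Icc (-δ) δ := by
      rw [Set.mem_Icc, ← abs_le, abs_div, div_le_iff₀ (abs_pos.2 hv)]
      exact hw
    have := hcl hmem
    simpa [F, div_mul_cancel₀ _ hv] using this
  · rintro ⟨P, hP, ε, hε, h⟩
    refine ⟨P, hP, ε, hε, fun x => ?_⟩
    have := h x _ (abs_logQuantizer_sub_le hδ₀ hδ₁ hu₀ (v := K ⬝ᵥ x))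
    have hstep : closedLoop A B K *ᵥ x +
        (logQuantizer ((1 - δ) / (1 + δ)) u₀ (K ⬝ᵥ x) - K ⬝ᵥ x) • B =
        closedLoopStep A B K ((1 - δ) / (1 + δ)) u₀ x := by
      rw [closedLoopStep, closedLoop_mulVec, sub_smul]
      abel
    rwa [hstep] at this

/-! ### Real and imaginary parts of complex state trajectories -/

theorem re_map_ofReal_mulVec {n : ℕ} (M : Matrix (Fin n) (Fin n) ℝ) (ξ : Fin n → ℂ) (i : Fin n) :
    ((M.map Complex.ofReal *ᵥ ξ) i).re = (M *ᵥ fun j => (ξ j).re) i := by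
  simp [Matrix.mulVec, dotProduct]

theorem im_map_ofReal_mulVec {n : ℕ} (M : Matrix (Fin n) (Fin n) ℝ) (ξ : Fin n → ℂ) (i : Fin n) :
    ((M.map Complex.ofReal *ᵥ ξ) i).im = (M *ᵥ fun j => (ξ j).im) i := by
  simp [Matrix.mulVec, dotProduct]

theorem re_ofReal_dotProduct {n : ℕ} (K : Fin n → ℝ) (ξ : Fin n → ℂ) :
    ((fun i => (K i : ℂ)) ⬝ᵥ ξ).re = K ⬝ᵥ fun j => (ξ j).re := by
  simp [dotProduct]

theorem im_ofReal_dotProduct {n : ℕ} (K : Fin n → ℝ) (ξ : Fin n → ℂ) :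
    ((fun i => (K i : ℂ)) ⬝ᵥ ξ).im = K ⬝ᵥ fun j => (ξ j).im := by
  simp [dotProduct]

/-- A quadratic form is homogeneous of degree two under multiplication of `a + i b` by a complex
number `p + i q`. -/
theorem quadForm_complex_smul {n : ℕ} (P : Matrix (Fin n) (Fin n) ℝ) (a b : Fin n → ℝ) (p q : ℝ) :
    (p • a - q • b) ⬝ᵥ (P *ᵥ (p • a - q • b)) + (q • a + p • b) ⬝ᵥ (P *ᵥ (q • a + p • b)) =
      (p ^ 2 + q ^ 2) * (a ⬝ᵥ (P *ᵥ a) + b ⬝ᵥ (P *ᵥ b)) := by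
  simp only [Matrix.mulVec_add, Matrix.mulVec_sub, Matrix.mulVec_smul, dotProduct_add,
    dotProduct_sub, add_dotProduct, sub_dotProduct, smul_dotProduct, dotProduct_smul, smul_eq_mul]
  ring

/-- Half of the rotation taking c to the positive imaginary axis. This phase lets a complex sector
bound split into separate bounds for real and imaginary parts. -/
theorem exists_sq_eq_norm_one_re_mul_eq_zero (c : ℂ) :
    ∃ e : ℂ, ‖e‖ = 1 ∧ (c * e ^ 2).re = 0 := by
  refine ⟨Complex.exp (((Real.pi / 2 - c.arg) / 2 : ℝ) * Complex.I),
    Complex.norm_exp_ofReal_mul_I _, ?_⟩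
  have : c * Complex.exp (((Real.pi / 2 - c.arg) / 2 : ℝ) * Complex.I) ^ 2 = ‖c‖ * Complex.I := by
    nth_rewrite 1 [← Complex.norm_mul_exp_arg_mul_I c]
    rw [← Complex.exp_nat_mul, mul_assoc, ← Complex.exp_add]
    have : (c.arg : ℂ) * Complex.I + (2 : ℕ) * ((((Real.pi / 2 - c.arg) / 2 : ℝ) : ℂ) * Complex.I)
        = Real.pi / 2 * Complex.I := by
      push_cast
      ring
    rw [this, Complex.exp_pi_div_two_mul_I]
  rw [this]
  simp

/-- Complex form of the Lyapunov inequality: `z ξ = M ξ + ω B` with `|ω| ≤ δ |K ξ|` and `|z| ≥ 1`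
is impossible for `ξ ≠ 0`. -/
theorem SectorStable.eq_zero_of_smul_eq {n : ℕ} {M : Matrix (Fin n) (Fin n) ℝ}
    {B K : Fin n → ℝ} {δ : ℝ} (hδ₀ : 0 ≤ δ) (h : SectorStable M B K δ) {z ω : ℂ} {ξ : Fin n → ℂ}
    (hz : 1 ≤ ‖z‖)
    (heq : z • ξ = M.map Complex.ofReal *ᵥ ξ + ω • fun i => (B i : ℂ))
    (hω : ‖ω‖ ≤ δ * ‖(fun i => (K i : ℂ)) ⬝ᵥ ξ‖) : ξ = 0 := by
  obtain ⟨P, hP, ε, hε, h⟩ := h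
  -- After rotating by e, δ²κ² - o² is purely imaginary; adding this to, or subtracting it from,
  -- |o|² ≤ δ²|κ|² bounds each part of o by the same part of κ.
  obtain ⟨e, he, hre⟩ := exists_sq_eq_norm_one_re_mul_eq_zero
    (δ ^ 2 * ((fun i => (K i : ℂ)) ⬝ᵥ ξ) ^ 2 - ω ^ 2)
  set η : Fin n → ℂ := e • ξ with hη
  set κ : ℂ := (fun i => (K i : ℂ)) ⬝ᵥ η with hκ
  set o : ℂ := e * ω with ho
  have hκe : κ = e * ((fun i => (K i : ℂ)) ⬝ᵥ ξ) := by
    rw [hκ, hη, dotProduct_smul, smul_eq_mul]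
  have heq' : z • η = M.map Complex.ofReal *ᵥ η + o • fun i => (B i : ℂ) := by
    rw [hη, smul_comm, heq, Matrix.mulVec_smul, smul_add, smul_smul]
  have hnorm : ‖o‖ ≤ δ * ‖κ‖ := by
    rw [hκe, ho, norm_mul, norm_mul, he, one_mul, one_mul]
    exact hω
  have hsum : o.re ^ 2 + o.im ^ 2 ≤ δ ^ 2 * (κ.re ^ 2 + κ.im ^ 2) := by
    have h1 : ‖o‖ ^ 2 ≤ (δ * ‖κ‖) ^ 2 := pow_le_pow_left₀ (norm_nonneg _) hnorm 2
    rw [mul_pow, ← Complex.normSq_eq_norm_sq, ← Complex.normSq_eq_norm_sq, Complex.normSq_apply,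
      Complex.normSq_apply] at h1
    nlinarith
  have hdiff : δ ^ 2 * (κ.re ^ 2 - κ.im ^ 2) = o.re ^ 2 - o.im ^ 2 := by
    have : (δ ^ 2 * ((fun i => (K i : ℂ)) ⬝ᵥ ξ) ^ 2 - ω ^ 2) * e ^ 2 =
        ((δ ^ 2 : ℝ) : ℂ) * κ ^ 2 - o ^ 2 := by
      rw [hκe, ho]
      push_cast
      ring
    rw [this, Complex.sub_re, Complex.re_ofReal_mul] at hre
    simp only [pow_two, Complex.mul_re] at hre ⊢
    linarith
  have hre_le : |o.re| ≤ δ * |κ.re| := by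
    rw [← abs_of_nonneg hδ₀, ← abs_mul]
    apply sq_le_sq.1
    nlinarith
  have him_le : |o.im| ≤ δ * |κ.im| := by
    rw [← abs_of_nonneg hδ₀, ← abs_mul]
    apply sq_le_sq.1
    nlinarith
  rw [hκ, re_ofReal_dotProduct] at hre_le
  rw [hκ, im_ofReal_dotProduct] at him_le
  set a : Fin n → ℝ := fun j => (η j).re with ha
  set b : Fin n → ℝ := fun j => (η j).im with hb
  have hra : M *ᵥ a + o.re • B = z.re • a - z.im • b := by
    ext i
    have := congrArg Complex.re (congrFun heq' i)
    simp only [Pi.smul_apply, Pi.add_apply, smul_eq_mul, Complex.add_re, re_map_ofReal_mulVec,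
      Complex.mul_re, Complex.ofReal_re, Complex.ofReal_im] at this
    simp [ha, hb, this]
  have hrb : M *ᵥ b + o.im • B = z.im • a + z.re • b := by
    ext i
    have := congrArg Complex.im (congrFun heq' i)
    simp only [Pi.smul_apply, Pi.add_apply, smul_eq_mul, Complex.add_im, im_map_ofReal_mulVec,
      Complex.mul_im, Complex.ofReal_re, Complex.ofReal_im] at this
    simp [ha, hb]
    linarith
  have h1 := h a o.re hre_le
  have h2 := h b o.im him_le
  rw [hra] at h1
  rw [hrb] at h2
  have h3 := quadForm_complex_smul P a b z.re z.im
  have hz2 : 1 ≤ z.re ^ 2 + z.im ^ 2 := by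
    have : 1 ≤ ‖z‖ ^ 2 := one_le_pow₀ hz
    rw [← Complex.normSq_eq_norm_sq, Complex.normSq_apply] at this
    nlinarith
  have hPa : 0 ≤ a ⬝ᵥ (P *ᵥ a) := by simpa using hP.posSemidef.dotProduct_mulVec_nonneg a
  have hPb : 0 ≤ b ⬝ᵥ (P *ᵥ b) := by simpa using hP.posSemidef.dotProduct_mulVec_nonneg b
  have haa : 0 ≤ a ⬝ᵥ a := by simpa using dotProduct_star_self_nonneg a
  have hbb : 0 ≤ b ⬝ᵥ b := by simpa using dotProduct_star_self_nonneg b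
  -- Summing the two real inequalities gives |z|²V ≤ V - ε(|a|² + |b|²), where V = aᵀPa + bᵀPb ≥ 0
  -- and |z| ≥ 1.
  have hle : ε * (a ⬝ᵥ a + b ⬝ᵥ b) ≤ 0 := by nlinarith
  have hle' : a ⬝ᵥ a + b ⬝ᵥ b ≤ 0 := by nlinarith
  have ha0 : a = 0 := dotProduct_self_eq_zero.1 (by linarith)
  have hb0 : b = 0 := dotProduct_self_eq_zero.1 (by linarith)
  have hη0 : η = 0 := by
    ext i
    exact Complex.ext (congrFun ha0 i) (congrFun hb0 i)
  refine (smul_eq_zero.1 hη0).resolve_left ?_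
  rintro rfl
  simp at he

theorem exists_eigenvector_of_mem_spectrum {n : ℕ} {N : Matrix (Fin n) (Fin n) ℂ} {z : ℂ}
    (hz : z ∈ spectrum ℂ N) : ∃ ξ : Fin n → ℂ, ξ ≠ 0 ∧ N *ᵥ ξ = z • ξ := by
  rw [spectrum.mem_iff, Matrix.isUnit_iff_isUnit_det, isUnit_iff_ne_zero, not_not] at hz
  obtain ⟨ξ, h0, h⟩ := Matrix.exists_mulVec_eq_zero_iff.2 hz
  refine ⟨ξ, h0, ?_⟩
  rw [Matrix.sub_mulVec, sub_eq_zero, Algebra.algebraMap_eq_smul_one, Matrix.smul_mulVec,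
    Matrix.one_mulVec] at h
  exact h.symm

theorem SectorStable.isSchur {n : ℕ} {M : Matrix (Fin n) (Fin n) ℝ}
    {B K : Fin n → ℝ} {δ : ℝ} (hδ₀ : 0 ≤ δ) (h : SectorStable M B K δ) : IsSchur M := by
  intro z hz
  by_contra! hz1
  obtain ⟨ξ, h0, hξ⟩ := exists_eigenvector_of_mem_spectrum hz
  refine h0 (h.eq_zero_of_smul_eq hδ₀ (ω := 0) hz1 (by rw [hξ]; simp) ?_)
  rw [norm_zero]
  positivity

theorem IsSchur.isUnit_det {n : ℕ} {M : Matrix (Fin n) (Fin n) ℝ} (h : IsSchur M) {z : ℂ}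
    (hz : ‖z‖ = 1) :
    IsUnit (z • (1 : Matrix (Fin n) (Fin n) ℂ) - M.map Complex.ofReal).det := by
  by_contra hd
  refine (h z ?_).ne hz
  rw [spectrum.mem_iff, Matrix.isUnit_iff_isUnit_det, Algebra.algebraMap_eq_smul_one]
  exact hd

/-- If δ|G(z)| ≥ 1, then ξ = (zI - M)⁻¹B with input ω = 1 obeys the sector bound, so ξ = 0 and G(z)
= Kξ = 0, a contradiction. -/
theorem SectorStable.norm_transferFn_lt {n : ℕ} {A : Matrix (Fin n) (Fin n) ℝ}
    {B K : Fin n → ℝ} {δ : ℝ} (hδ₀ : 0 < δ) (h : SectorStable (closedLoop A B K) B K δ) {z : ℂ}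
    (hz : ‖z‖ = 1) : δ * ‖transferFn A B K z‖ < 1 := by
  by_contra! hge
  set ξ : Fin n → ℂ := (z • (1 : Matrix (Fin n) (Fin n) ℂ) -
    (closedLoop A B K).map Complex.ofReal)⁻¹ *ᵥ fun i => (B i : ℂ) with hξ
  have hξ0 : ξ = 0 := by
    refine h.eq_zero_of_smul_eq hδ₀.le (z := z) (ω := 1) hz.ge ?_ ?_
    · have hu := (h.isSchur hδ₀.le).isUnit_det hz
      have : (z • (1 : Matrix (Fin n) (Fin n) ℂ) -
          (closedLoop A B K).map Complex.ofReal) *ᵥ ξ = fun i => (B i : ℂ) := by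
        rw [hξ, Matrix.mulVec_mulVec, Matrix.mul_nonsing_inv _ hu, Matrix.one_mulVec]
      rw [one_smul, ← this, Matrix.sub_mulVec, Matrix.smul_mulVec, Matrix.one_mulVec]
      abel
    · simpa [transferFn] using hge
  have : transferFn A B K z = 0 := by
    rw [transferFn, ← hξ, hξ0, dotProduct_zero]
  rw [this] at hge
  simp at hge
  linarith

/-! ### Powers of Schur matrices -/

section PowerDecay

attribute [local instance] Matrix.linftyOpNormedRing Matrix.linftyOpNormedAlgebra

/-- Gelfand's formula: ‖Nᵏ‖^(1/k) tends to the spectral radius, so ‖Nᵏ‖ ≤ rᵏ eventually for some r <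
1. -/
theorem tendsto_pow_mulVec_of_spectrum {n : ℕ} {N : Matrix (Fin n) (Fin n) ℂ}
    (h : ∀ z ∈ spectrum ℂ N, ‖z‖ < 1) (v : Fin n → ℂ) :
    Filter.Tendsto (fun k : ℕ => N ^ k *ᵥ v) Filter.atTop (nhds 0) := by
  rcases isEmpty_or_nonempty (Fin n) with hn | hn
  · exact tendsto_const_nhds.congr fun k => Subsingleton.elim _ _
  have hr : spectralRadius ℂ N < (1 : NNReal) :=
    spectrum.spectralRadius_lt_of_forall_lt N fun z hz => by
      rw [← NNReal.coe_lt_coe]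
      simpa using h z hz
  obtain ⟨r, hr1, hr2⟩ := ENNReal.lt_iff_exists_nnreal_btwn.1 hr
  have hr2' : r < 1 := by exact_mod_cast hr2
  have hev := (spectrum.pow_nnnorm_pow_one_div_tendsto_nhds_spectralRadius N).eventually_lt_const hr1
  have hpow : Filter.Tendsto (fun k : ℕ => ‖N ^ k‖) Filter.atTop (nhds 0) := by
    have hgeo : Filter.Tendsto (fun k : ℕ => (r : ℝ) ^ k) Filter.atTop (nhds 0) :=
      tendsto_pow_atTop_nhds_zero_of_lt_one r.2 (by exact_mod_cast hr2')
    refine squeeze_zero' (Filter.Eventually.of_forall fun k => norm_nonneg _) ?_ hgeo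
    filter_upwards [hev, Filter.eventually_gt_atTop 0] with k hk hk0
    have hk' : (0 : ℝ) < k := by exact_mod_cast hk0
    have h1 := ENNReal.rpow_lt_rpow hk hk'
    rw [← ENNReal.rpow_mul, one_div_mul_cancel hk'.ne', ENNReal.rpow_one, ENNReal.rpow_natCast] at h1
    have h2 : ‖N ^ k‖₊ < r ^ k := by exact_mod_cast h1
    exact_mod_cast h2.le
  refine squeeze_zero_norm (a := fun k : ℕ => ‖N ^ k‖ * ‖v‖)
    (fun k => Matrix.linfty_opNorm_mulVec _ _) ?_
  simpa using hpow.mul_const ‖v‖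

end PowerDecay

theorem IsSchur.tendsto_pow_mulVec {n : ℕ} {M : Matrix (Fin n) (Fin n) ℝ} (h : IsSchur M)
    (x : Fin n → ℝ) :
    Filter.Tendsto (fun k : ℕ => M ^ k *ᵥ x) Filter.atTop (nhds 0) := by
  have h1 := tendsto_pow_mulVec_of_spectrum h (fun i => (x i : ℂ))
  rw [tendsto_pi_nhds] at h1 ⊢
  intro i
  have h2 := (Complex.continuous_re.tendsto _).comp (h1 i)
  simp only [Pi.zero_apply, Complex.zero_re] at h2 ⊢
  refine h2.congr fun k => ?_
  have : (M.map Complex.ofReal) ^ k = (M ^ k).map Complex.ofReal :=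
    (Matrix.map_pow M Complex.ofRealHom k).symm
  simp only [Function.comp]
  rw [this, re_map_ofReal_mulVec]
  simp

/-- A quadratic form that decreases strictly along a stable linear system is positive. -/
theorem IsSchur.quadForm_pos {n : ℕ} {M P : Matrix (Fin n) (Fin n) ℝ} (h : IsSchur M)
    (hdec : ∀ x : Fin n → ℝ, x ≠ 0 → (M *ᵥ x) ⬝ᵥ (P *ᵥ (M *ᵥ x)) < x ⬝ᵥ (P *ᵥ x))
    {x : Fin n → ℝ} (hx : x ≠ 0) : 0 < x ⬝ᵥ (P *ᵥ x) := by
  have hlim := h.tendsto_pow_mulVec x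
  have hV : Filter.Tendsto (fun k : ℕ => (M ^ k *ᵥ x) ⬝ᵥ (P *ᵥ (M ^ k *ᵥ x))) Filter.atTop
      (nhds 0) := by
    have hc : Continuous fun y : Fin n → ℝ => y ⬝ᵥ (P *ᵥ y) := by fun_prop
    have h1 := (hc.tendsto 0).comp hlim
    rwa [zero_dotProduct] at h1
  have hanti : Antitone fun k : ℕ => (M ^ k *ᵥ x) ⬝ᵥ (P *ᵥ (M ^ k *ᵥ x)) := by
    refine antitone_nat_of_succ_le fun k => ?_
    rw [pow_succ', ← Matrix.mulVec_mulVec]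
    by_cases h0 : M ^ k *ᵥ x = 0
    · simp [h0]
    · exact (hdec _ h0).le
  -- Writing V for the form, V(x) > V(Mx) ≥ lim V(Mᵏx) = 0.
  have h1 := hanti.le_of_tendsto hV 1
  simp only [pow_one] at h1
  exact h1.trans_lt (hdec x hx)

/-! ### Isometries of finite-dimensional complex inner product spaces -/

section Isometry

variable {E : Type*} [NormedAddCommGroup E] [InnerProductSpace ℂ E]

theorem norm_eq_one_of_isometry_eigenvector (Q : E →ₗᵢ[ℂ] E) {μ : ℂ} {v : E} (hv : v ≠ 0)
    (h : Q v = μ • v) : ‖μ‖ = 1 := by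
  have h1 := Q.norm_map v
  rw [h, norm_smul] at h1
  exact mul_right_cancel₀ (norm_ne_zero_iff.2 hv) (h1.trans (one_mul _).symm)

theorem inner_isometry_eq_zero_of_eigenvector (Q : E →ₗᵢ[ℂ] E) {μ : ℂ} {v w : E}
    (h : Q v = μ • v) (hvw : inner ℂ v w = 0) : inner ℂ v (Q w) = 0 := by
  by_cases hv : v = 0
  · simp [hv]
  have hμ : μ ≠ 0 := by
    rintro rfl
    simpa using norm_eq_one_of_isometry_eigenvector Q hv h
  have h1 := Q.inner_map_map v w
  rw [h, inner_smul_left, hvw] at h1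
  exact (mul_eq_zero.1 h1).resolve_left (by simpa using hμ)

theorem orthogonalFamily_eigenspaces_of_isometry (Q : E →ₗᵢ[ℂ] E) :
    OrthogonalFamily ℂ (fun μ : Module.End.Eigenvalues Q.toLinearMap =>
      Module.End.eigenspace Q.toLinearMap μ)
      fun μ => (Module.End.eigenspace Q.toLinearMap μ).subtypeₗᵢ := by
  rintro ⟨μ, hμe⟩ ⟨ν, hνe⟩ hμν ⟨v, hv⟩ ⟨w, hw⟩
  have hμν' : μ ≠ ν := fun h => hμν (Subtype.ext h)
  simp only [Module.End.mem_eigenspace_iff, LinearIsometry.coe_toLinearMap] at hv hw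
  change inner ℂ v w = 0
  by_cases hv0 : v = 0
  · simp [hv0]
  have hn : ‖μ‖ = 1 := norm_eq_one_of_isometry_eigenvector Q hv0 hv
  have h1 := Q.inner_map_map v w
  change Q v = μ • v at hv
  change Q w = ν • w at hw
  rw [hv, hw, inner_smul_left, inner_smul_right, ← mul_assoc] at h1
  by_contra hne
  have h2 : (starRingEnd ℂ) μ * ν = 1 := mul_right_cancel₀ hne (h1.trans (one_mul _).symm)
  have h3 : (starRingEnd ℂ) μ * μ = 1 := by
    rw [mul_comm, Complex.mul_conj, Complex.normSq_eq_norm_sq, hn]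
    simp
  have h4 : (starRingEnd ℂ) μ ≠ 0 := by
    intro h0
    rw [h0, zero_mul] at h3
    exact zero_ne_one h3
  exact hμν' (mul_left_cancel₀ h4 (h3.trans h2.symm))

variable [FiniteDimensional ℂ E]

/-- The complement is Q-invariant; if nonzero it would contain an eigenvector of Q, which would be
orthogonal to itself. -/
theorem orthogonal_iSup_eigenspaces_of_isometry (Q : E →ₗᵢ[ℂ] E) :
    (⨆ μ : Module.End.Eigenvalues Q.toLinearMap,
      Module.End.eigenspace Q.toLinearMap μ)ᗮ = ⊥ := by
  set W := (⨆ μ : Module.End.Eigenvalues Q.toLinearMap,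
    Module.End.eigenspace Q.toLinearMap μ)ᗮ with hW
  have hmem : ∀ w, w ∈ W ↔ ∀ (μ : ℂ) (v : E), Q v = μ • v → inner ℂ v w = 0 := by
    intro w
    rw [hW, ← Submodule.iInf_orthogonal, Submodule.mem_iInf]
    constructor
    · intro h μ v hv
      by_cases hv0 : v = 0
      · simp [hv0]
      have hμ : Module.End.HasEigenvalue Q.toLinearMap μ :=
        Module.End.hasEigenvalue_of_hasEigenvector
          ⟨Module.End.mem_eigenspace_iff.2 hv, hv0⟩
      exact (Submodule.mem_orthogonal _ _).1 (h ⟨μ, hμ⟩) v (Module.End.mem_eigenspace_iff.2 hv)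
    · intro h μ
      rw [Submodule.mem_orthogonal]
      exact fun v hv => h μ v (Module.End.mem_eigenspace_iff.1 hv)
  have hinv : ∀ w ∈ W, Q.toLinearMap w ∈ W := by
    intro w hw
    rw [hmem] at hw ⊢
    exact fun μ v hv => inner_isometry_eq_zero_of_eigenvector Q hv (hw μ v hv)
  by_contra hne
  have : Nontrivial W := Submodule.nontrivial_iff_ne_bot.2 hne
  obtain ⟨μ, hμ⟩ := Module.End.exists_eigenvalue (Q.toLinearMap.restrict hinv)
  obtain ⟨v, hv⟩ := hμ.exists_hasEigenvector
  have hv1 : Q (v : E) = μ • (v : E) := congrArg Subtype.val hv.apply_eq_smul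
  have h0 := (hmem v).1 v.2 μ v hv1
  exact hv.2 (Subtype.ext (inner_self_eq_zero.1 h0))

theorem exists_eigenbasis_of_isometry (Q : E →ₗᵢ[ℂ] E) :
    ∃ (b : OrthonormalBasis (Fin (Module.finrank ℂ E)) ℂ E) (μ : Fin (Module.finrank ℂ E) → ℂ),
      ∀ j, Q (b j) = μ j • b j := by
  have hint : DirectSum.IsInternal fun μ : Module.End.Eigenvalues Q.toLinearMap =>
      Module.End.eigenspace Q.toLinearMap μ :=
    (orthogonalFamily_eigenspaces_of_isometry Q).isInternal_iff.2
      (orthogonal_iSup_eigenspaces_of_isometry Q)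
  refine ⟨hint.subordinateOrthonormalBasis rfl (orthogonalFamily_eigenspaces_of_isometry Q),
    fun j => ((hint.subordinateOrthonormalBasisIndex rfl j
      (orthogonalFamily_eigenspaces_of_isometry Q) : Module.End.Eigenvalues Q.toLinearMap) : ℂ),
    fun j => ?_⟩
  exact Module.End.mem_eigenspace_iff.1 (hint.subordinateOrthonormalBasis_subordinate rfl j
    (orthogonalFamily_eigenspaces_of_isometry Q))

/-- Two linear maps with equal norms differ by an isometry of the codomain. -/
theorem exists_isometry_comp_eq {F : Type*} [AddCommGroup F] [Module ℂ F] (f g : F →ₗ[ℂ] E)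
    (h : ∀ v, ‖f v‖ = ‖g v‖) : ∃ Q : E →ₗᵢ[ℂ] E, ∀ v, Q (f v) = g v := by
  -- Equal norms give ker f = ker g, so g ∘ s does not depend on the section s and is isometric on
  -- the range of f.
  obtain ⟨s, hs⟩ := f.rangeRestrict.exists_rightInverse_of_surjective f.range_rangeRestrict
  have hs' : ∀ y : LinearMap.range f, f (s y) = y := fun y =>
    congrArg Subtype.val (LinearMap.congr_fun hs y)
  let L : LinearMap.range f →ₗᵢ[ℂ] E :=
    { toLinearMap := g ∘ₗ s
      norm_map' := fun y => by
        rw [LinearMap.comp_apply, ← h, hs']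
        rfl }
  refine ⟨L.extend, fun v => ?_⟩
  have h1 := L.extend_apply ⟨f v, LinearMap.mem_range_self f v⟩
  rw [h1]
  change g (s ⟨f v, _⟩) = g v
  rw [← sub_eq_zero, ← map_sub, ← norm_eq_zero, ← h, map_sub, hs', sub_self, norm_zero]

end Isometry

/-! ### Stationary second moments and the frequency response -/

theorem transferFn_mul_eq {n : ℕ} {A : Matrix (Fin n) (Fin n) ℝ} {B K : Fin n → ℝ}
    (hS : IsSchur (closedLoop A B K)) {z υ : ℂ} (hz : ‖z‖ = 1) {ξ : Fin n → ℂ}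
    (h : z • ξ = (closedLoop A B K).map Complex.ofReal *ᵥ ξ + υ • fun i => (B i : ℂ)) :
    ξ = υ • ((z • (1 : Matrix (Fin n) (Fin n) ℂ) -
      (closedLoop A B K).map Complex.ofReal)⁻¹ *ᵥ fun i => (B i : ℂ)) := by
  have h1 : (z • (1 : Matrix (Fin n) (Fin n) ℂ) - (closedLoop A B K).map Complex.ofReal) *ᵥ ξ =
      υ • fun i => (B i : ℂ) := by
    rw [Matrix.sub_mulVec, Matrix.smul_mulVec, Matrix.one_mulVec, h]
    abel
  rw [← Matrix.mulVec_smul, ← h1, Matrix.mulVec_mulVec,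
    Matrix.nonsing_inv_mul _ (hS.isUnit_det hz), Matrix.one_mulVec]

theorem sum_sq_dotProduct {n : ℕ} {ι : Type*} [Fintype ι] (x : ι → Fin n → ℝ) (a : Fin n → ℝ) :
    ∑ k, (a ⬝ᵥ x k) ^ 2 = ∑ i, ∑ j, a i * a j * ∑ k, x k i * x k j := by
  have h : ∀ k, (a ⬝ᵥ x k) ^ 2 = ∑ i, ∑ j, a i * a j * (x k i * x k j) := by
    intro k
    rw [pow_two, dotProduct, Finset.sum_mul_sum]
    exact Finset.sum_congr rfl fun i _ => Finset.sum_congr rfl fun j _ => by ring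
  simp only [h, Finset.mul_sum]
  rw [Finset.sum_comm]
  exact Finset.sum_congr rfl fun i _ => Finset.sum_comm

/-- The complex linear map `v ↦ (x_k ⬝ v)_k` of a finite family of real vectors. -/
def analysisMap {n : ℕ} {ι : Type*} [Fintype ι] (x : ι → Fin n → ℝ) :
    (Fin n → ℂ) →ₗ[ℂ] EuclideanSpace ℂ ι where
  toFun v := WithLp.toLp 2 fun k => (fun i => (x k i : ℂ)) ⬝ᵥ v
  map_add' v v' := by
    ext k
    simp [dotProduct_add]
  map_smul' c v := by
    ext k
    simp [dotProduct_smul]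

theorem analysisMap_single {n : ℕ} {ι : Type*} [Fintype ι] (x : ι → Fin n → ℝ) (i : Fin n)
    (k : ι) : analysisMap x (Pi.single i 1) k = x k i := by
  simp [analysisMap]

theorem norm_sq_analysisMap {n : ℕ} {ι : Type*} [Fintype ι] (x : ι → Fin n → ℝ) (v : Fin n → ℂ) :
    ‖analysisMap x v‖ ^ 2 = ∑ k, ((fun i => (v i).re) ⬝ᵥ x k) ^ 2 +
      ∑ k, ((fun i => (v i).im) ⬝ᵥ x k) ^ 2 := by
  rw [EuclideanSpace.norm_sq_eq, ← Finset.sum_add_distrib]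
  refine Finset.sum_congr rfl fun k _ => ?_
  rw [← Complex.normSq_eq_norm_sq, Complex.normSq_apply]
  simp only [analysisMap, LinearMap.coe_mk, AddHom.coe_mk]
  rw [re_ofReal_dotProduct, im_ofReal_dotProduct, dotProduct_comm (x k), dotProduct_comm (x k)]
  ring

/-- If the second moments of finitely many state-input pairs are invariant under the closed loop
and the state outputs dominate the inputs, then all pairs vanish. -/
theorem eq_zero_of_stationary {n : ℕ} {A : Matrix (Fin n) (Fin n) ℝ} {B K : Fin n → ℝ} {δ : ℝ}
    (hδ : 0 ≤ δ) (hS : IsSchur (closedLoop A B K))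
    (hG : ∀ z : ℂ, ‖z‖ = 1 → δ * ‖transferFn A B K z‖ < 1)
    {ι : Type*} [Fintype ι] (x : ι → Fin n → ℝ) (w : ι → ℝ)
    (hstat : ∀ i j, ∑ k, (closedLoop A B K *ᵥ x k + w k • B) i *
      (closedLoop A B K *ᵥ x k + w k • B) j = ∑ k, x k i * x k j)
    (hc : ∑ k, w k ^ 2 ≤ δ ^ 2 * ∑ k, (K ⬝ᵥ x k) ^ 2) :
    x = 0 ∧ w = 0 := by
  set y : ι → Fin n → ℝ := fun k => closedLoop A B K *ᵥ x k + w k • B with hy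
  have hnorm : ∀ v, ‖analysisMap x v‖ = ‖analysisMap y v‖ := by
    intro v
    rw [← sq_eq_sq₀ (norm_nonneg _) (norm_nonneg _), norm_sq_analysisMap, norm_sq_analysisMap]
    simp only [sum_sq_dotProduct, hy, hstat]
  -- Stationarity says that the coordinate sequences of x and of its successor y have equal Gram
  -- matrices, hence differ by an isometry Q.
  obtain ⟨Q, hQ⟩ := exists_isometry_comp_eq _ _ hnorm
  obtain ⟨b, μ, hb⟩ := exists_eigenbasis_of_isometry Q
  have hμ : ∀ j, ‖μ j‖ = 1 := fun j =>
    norm_eq_one_of_isometry_eigenvector Q (b.orthonormal.ne_zero j) (hb j)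
  set W : EuclideanSpace ℂ ι := WithLp.toLp 2 fun k => (w k : ℂ) with hW
  set e : Fin n → Fin n → ℂ := fun i => Pi.single i 1 with he
  set ξ : Fin (Module.finrank ℂ (EuclideanSpace ℂ ι)) → Fin n → ℂ :=
    fun j i => inner ℂ (b j) (analysisMap x (e i)) with hξ
  set υ : Fin (Module.finrank ℂ (EuclideanSpace ℂ ι)) → ℂ := fun j => inner ℂ (b j) W with hυ
  have hye : ∀ i, analysisMap y (e i) =
      ∑ l, ((closedLoop A B K i l : ℝ) : ℂ) • analysisMap x (e l) + (B i : ℂ) • W := by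
    intro i
    ext k
    simp only [e, W, y, PiLp.add_apply, PiLp.smul_apply, WithLp.ofLp_sum, Finset.sum_apply,
      analysisMap_single, Pi.add_apply, Pi.smul_apply, smul_eq_mul, Matrix.mulVec, dotProduct]
    push_cast
    ring
  have hshift : ∀ j v, inner ℂ (b j) (analysisMap y v) = μ j * inner ℂ (b j) (analysisMap x v) := by
    intro j v
    have h1 := Q.inner_map_map (b j) (analysisMap x v)
    rw [hQ, hb, inner_smul_left] at h1
    rw [← h1, ← mul_assoc, Complex.mul_conj, Complex.normSq_eq_norm_sq, hμ]
    simp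
  -- Along an eigenvector of Q the shift x ↦ y is multiplication by μ j, so the dynamics become a
  -- steady state at the frequency μ j.
  have heq : ∀ j, μ j • ξ j =
      (closedLoop A B K).map Complex.ofReal *ᵥ ξ j + υ j • fun i => (B i : ℂ) := by
    intro j
    ext i
    have h1 := hshift j (e i)
    rw [hye, inner_add_right, inner_sum, inner_smul_right] at h1
    simp only [inner_smul_right] at h1
    simp only [Pi.smul_apply, smul_eq_mul, Pi.add_apply, Matrix.mulVec, dotProduct, Matrix.map_apply]
    rw [mul_comm (υ j)]
    exact h1.symm
  have hsol := fun j => transferFn_mul_eq hS (hμ j) (heq j)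
  have hKξ : ∀ j, inner ℂ (b j) (analysisMap x fun i => (K i : ℂ)) =
      υ j * transferFn A B K (μ j) := by
    intro j
    have h1 : (fun i => (K i : ℂ)) = ∑ i, (K i : ℂ) • e i := by
      ext i
      simp [e, Finset.sum_apply, Pi.single_apply]
    rw [h1, map_sum, inner_sum]
    simp only [map_smul, inner_smul_right]
    change (fun i => (K i : ℂ)) ⬝ᵥ ξ j = _
    rw [hsol j, dotProduct_smul]
    rfl
  have hsumυ : ∑ j, ‖υ j‖ ^ 2 = ∑ k, w k ^ 2 := by
    rw [b.sum_sq_norm_inner_right W, EuclideanSpace.norm_sq_eq]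
    simp [W]
  have hsumK : ∑ j, (‖υ j‖ * ‖transferFn A B K (μ j)‖) ^ 2 = ∑ k, (K ⬝ᵥ x k) ^ 2 := by
    simp only [← norm_mul, ← hKξ]
    rw [b.sum_sq_norm_inner_right, norm_sq_analysisMap]
    simp [dotProduct]
  have hle : ∀ j, δ ^ 2 * (‖υ j‖ * ‖transferFn A B K (μ j)‖) ^ 2 ≤ ‖υ j‖ ^ 2 := by
    intro j
    have h1 : (δ * ‖transferFn A B K (μ j)‖) ^ 2 ≤ 1 :=
      pow_le_one₀ (by positivity) (hG _ (hμ j)).le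
    nlinarith [sq_nonneg ‖υ j‖]
  -- By Parseval, a nonzero υ j would make δ²∑(Kx)² strictly smaller than ∑w².
  have hυ0 : ∀ j, υ j = 0 := by
    intro j
    by_contra hj
    have hlt : ∑ j, δ ^ 2 * (‖υ j‖ * ‖transferFn A B K (μ j)‖) ^ 2 < ∑ j, ‖υ j‖ ^ 2 := by
      refine Finset.sum_lt_sum (fun j _ => hle j) ⟨j, Finset.mem_univ _, ?_⟩
      have h1 : (δ * ‖transferFn A B K (μ j)‖) ^ 2 < 1 :=
        pow_lt_one₀ (by positivity) (hG _ (hμ j)) two_ne_zero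
      have h2 : 0 < ‖υ j‖ ^ 2 := by positivity
      nlinarith
    rw [← Finset.mul_sum, hsumυ, hsumK] at hlt
    exact absurd hc (not_le.2 hlt)
  have hξ0 : ∀ j i, ξ j i = 0 := by
    intro j i
    rw [hsol j, hυ0 j, zero_smul]
    rfl
  constructor
  · ext k i
    have h1 : ‖analysisMap x (e i)‖ ^ 2 = 0 := by
      rw [← b.sum_sq_norm_inner_right]
      refine Finset.sum_eq_zero fun j _ => ?_
      change ‖ξ j i‖ ^ 2 = 0
      rw [hξ0]
      simp
    have h2 : analysisMap x (e i) = 0 := by simpa using h1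
    have h3 := congrArg (fun p : EuclideanSpace ℂ ι => p k) h2
    simpa [analysisMap, e] using h3
  · ext k
    have h1 : ∑ k, w k ^ 2 = 0 := by
      rw [← hsumυ]
      exact Finset.sum_eq_zero fun j _ => by simp [hυ0 j]
    have h2 := (Finset.sum_eq_zero_iff_of_nonneg fun k _ => sq_nonneg (w k)).1 h1 k
      (Finset.mem_univ k)
    simpa using h2

/-! ### Existence of a Lyapunov matrix by separation -/

/-- The spectraplex: positive semidefinite matrices of trace one. -/
def spectraplex (κ : Type*) [Fintype κ] : Set (κ → κ → ℝ) :=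
  {Z | (Matrix.of Z).PosSemidef ∧ ∑ a, Z a a = 1}

theorem convex_spectraplex (κ : Type*) [Fintype κ] : Convex ℝ (spectraplex κ) := by
  rintro Z ⟨hZ, hZ1⟩ Z' ⟨hZ', hZ1'⟩ a b ha hb hab
  refine ⟨(hZ.smul ha).add (hZ'.smul hb), ?_⟩
  simp [Finset.sum_add_distrib, ← Finset.mul_sum, hZ1, hZ1', hab]

theorem isClosed_setOf_posSemidef (κ : Type*) [Fintype κ] :
    IsClosed {Z : Matrix κ κ ℝ | Z.PosSemidef} := by
  have : {Z : Matrix κ κ ℝ | Z.PosSemidef} =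
      {Z | Zᵀ = Z} ∩ ⋂ v : κ → ℝ, {Z | 0 ≤ v ⬝ᵥ (Z *ᵥ v)} := by
    ext Z
    simp only [Set.mem_ofPred_eq, Set.mem_inter_iff, Set.mem_iInter,
      Matrix.posSemidef_iff_dotProduct_mulVec, Matrix.IsHermitian,
      Matrix.conjTranspose_eq_transpose_of_trivial, star_trivial]
  rw [this]
  refine (isClosed_eq (by fun_prop) continuous_id).inter (isClosed_iInter fun v => ?_)
  exact isClosed_le continuous_const (by fun_prop)

theorem abs_le_trace_of_posSemidef {κ : Type*} [Fintype κ] {Z : Matrix κ κ ℝ}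
    (hZ : Z.PosSemidef) (a b : κ) : |Z a b| ≤ ∑ c, Z c c := by
  obtain ⟨m, v, rfl⟩ := Matrix.posSemidef_iff_eq_sum_vecMulVec.1 hZ
  simp only [Matrix.sum_apply, Matrix.vecMulVec_apply, star_trivial]
  rw [Finset.sum_comm]
  refine (Finset.abs_sum_le_sum_abs _ _).trans (Finset.sum_le_sum fun i _ => ?_)
  have h1 : ∀ c, v i c * v i c ≤ ∑ c, v i c * v i c := fun c =>
    Finset.single_le_sum (f := fun c => v i c * v i c) (fun c _ => mul_self_nonneg _)
      (Finset.mem_univ c)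
  have ha := h1 a
  have hb := h1 b
  rw [abs_le]
  constructor
  · nlinarith [sq_nonneg (v i a + v i b)]
  · nlinarith [sq_nonneg (v i a - v i b)]

theorem isCompact_spectraplex (κ : Type*) [Fintype κ] : IsCompact (spectraplex κ) := by
  have hK : IsCompact (Set.univ.pi fun _ : κ => Set.univ.pi fun _ : κ => Set.Icc (-1 : ℝ) 1) :=
    isCompact_univ_pi fun _ => isCompact_univ_pi fun _ => isCompact_Icc
  refine hK.of_isClosed_subset ?_ ?_
  · refine IsClosed.inter (isClosed_setOf_posSemidef κ) ?_
    exact isClosed_eq (f := fun Z : κ → κ → ℝ => ∑ a, Z a a) (by fun_prop) continuous_const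
  · rintro Z ⟨hZ, hZ1⟩
    simp only [Set.mem_univ_pi, Set.mem_Icc]
    intro a b
    rw [← abs_le, ← hZ1]
    exact abs_le_trace_of_posSemidef hZ a b

/-- For second moments `Z` of a state-input pair, the increment of the second moments of the state
and the supply `δ² (K x)² - w²`. -/
def momentMap {n : ℕ} (M : Matrix (Fin n) (Fin n) ℝ) (B K : Fin n → ℝ) (δ : ℝ) :
    ((Fin n ⊕ Unit) → (Fin n ⊕ Unit) → ℝ) →ₗ[ℝ] (Fin n → Fin n → ℝ) × ℝ where
  toFun Z :=
    (fun i j => (∑ a, ∑ b, Sum.elim (M i) (fun _ => B i) a * Sum.elim (M j) (fun _ => B j) b *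
        Z a b) - Z (Sum.inl i) (Sum.inl j),
      δ ^ 2 * (∑ a, ∑ b, Sum.elim K 0 a * Sum.elim K 0 b * Z a b) - Z (Sum.inr ()) (Sum.inr ()))
  map_add' Z Z' := by
    ext
    · simp only [Pi.add_apply, mul_add, Finset.sum_add_distrib, Prod.mk_add_mk]
      ring
    · simp only [Pi.add_apply, mul_add, Finset.sum_add_distrib, Prod.mk_add_mk]
      ring
  map_smul' c Z := by
    ext
    · simp only [Pi.smul_apply, smul_eq_mul, mul_left_comm _ c, ← Finset.mul_sum, Prod.smul_mk,
        RingHom.id_apply]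
      ring
    · simp only [Pi.smul_apply, smul_eq_mul, mul_left_comm _ c, ← Finset.mul_sum, Prod.smul_mk,
        RingHom.id_apply]
      ring

theorem sum_sum_mul_mul {κ : Type*} [Fintype κ] (p q z : κ → ℝ) :
    ∑ a, ∑ b, p a * q b * (z a * z b) = (p ⬝ᵥ z) * (q ⬝ᵥ z) := by
  rw [dotProduct, dotProduct, Finset.sum_mul_sum]
  exact Finset.sum_congr rfl fun a _ => Finset.sum_congr rfl fun b _ => by ring

theorem momentMap_rankOne {n : ℕ} (M : Matrix (Fin n) (Fin n) ℝ) (B K : Fin n → ℝ) (δ : ℝ)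
    (z : Fin n ⊕ Unit → ℝ) :
    momentMap M B K δ (fun a b => z a * z b) =
      (fun i j => (M *ᵥ (z ∘ Sum.inl) + z (Sum.inr ()) • B) i *
          (M *ᵥ (z ∘ Sum.inl) + z (Sum.inr ()) • B) j - z (Sum.inl i) * z (Sum.inl j),
        δ ^ 2 * (K ⬝ᵥ (z ∘ Sum.inl)) ^ 2 - z (Sum.inr ()) ^ 2) := by
  simp only [momentMap, LinearMap.coe_mk, AddHom.coe_mk, sum_sum_mul_mul]
  ext
  · simp [dotProduct, Matrix.mulVec, mul_comm]
  · simp [dotProduct, pow_two]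

theorem mem_spectraplex_rankOne {κ : Type*} [Fintype κ] {z : κ → ℝ} (hz : 0 < z ⬝ᵥ z) :
    ((z ⬝ᵥ z)⁻¹ • fun a b => z a * z b) ∈ spectraplex κ := by
  constructor
  · have h1 := (Matrix.posSemidef_vecMulVec_self_star z).smul (inv_nonneg.2 hz.le)
    exact h1
  · simp only [Pi.smul_apply, smul_eq_mul, ← Finset.mul_sum]
    exact inv_mul_cancel₀ hz.ne'

/-- The coordinates of a separating functional: a matrix, which will yield P, and a multiplier for
the supply. -/
theorem clm_prod_eq_sum {n : ℕ} (f : ((Fin n → Fin n → ℝ) × ℝ) →L[ℝ] ℝ) (W : Fin n → Fin n → ℝ)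
    (s : ℝ) :
    f (W, s) = ∑ i, ∑ j, f (Pi.single i (Pi.single j 1), 0) * W i j + s * f (0, 1) := by
  have h : (W, s) = ∑ i, ∑ j, W i j •
      ((Pi.single i (Pi.single j 1), 0) : (Fin n → Fin n → ℝ) × ℝ) +
      s • ((0, 1) : (Fin n → Fin n → ℝ) × ℝ) := by
    ext i j
    · simp [Prod.fst_sum, Finset.sum_apply, Pi.single_apply, apply_ite]
    · simp [Prod.snd_sum]
  rw [h]
  simp only [map_add, map_sum, map_smul, smul_eq_mul, mul_comm]

/-- The strict bounded real lemma in discrete time, in the form of the existence of a common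
quadratic Lyapunov function. -/
theorem sectorStable_of_norm_transferFn_lt {n : ℕ} {A : Matrix (Fin n) (Fin n) ℝ}
    {B K : Fin n → ℝ} {δ : ℝ} (hδ : 0 ≤ δ) (hS : IsSchur (closedLoop A B K))
    (hG : ∀ z : ℂ, ‖z‖ = 1 → δ * ‖transferFn A B K z‖ < 1) :
    SectorStable (closedLoop A B K) B K δ := by
  set M := closedLoop A B K with hM
  set G := momentMap M B K δ with hGdef
  have hGc : Continuous G := G.continuous_of_finiteDimensional
  -- A common point is a moment matrix with zero increment and nonnegative supply. Its rank-one
  -- factors form a stationary family, hence vanish, against trace one.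
  have hdisj : Disjoint (G '' spectraplex (Fin n ⊕ Unit))
      (({0} : Set (Fin n → Fin n → ℝ)) ×ˢ Set.Ici (0 : ℝ)) := by
    rw [Set.disjoint_left]
    rintro _ ⟨Z, ⟨hZ, hZ1⟩, rfl⟩ ⟨h1, h2⟩
    obtain ⟨m, v, hv⟩ := Matrix.posSemidef_iff_eq_sum_vecMulVec.1 hZ
    have hZv : Z = ∑ k, fun a b => v k a * v k b := by
      ext a b
      have := congrFun (congrFun hv a) b
      simpa [Matrix.sum_apply, Matrix.vecMulVec_apply, Finset.sum_apply] using this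
    rw [hZv, map_sum] at h1 h2
    simp only [hGdef, momentMap_rankOne] at h1 h2
    rw [Set.mem_singleton_iff, Prod.fst_sum] at h1
    rw [Set.mem_Ici, Prod.snd_sum, Finset.sum_sub_distrib, sub_nonneg, ← Finset.mul_sum] at h2
    have h0 := eq_zero_of_stationary hδ hS hG (fun k => v k ∘ Sum.inl)
      (fun k => v k (Sum.inr ())) (fun i j => ?_) h2
    · have hv0 : ∀ k, v k = 0 := by
        intro k
        ext (i | i)
        · exact congrFun (congrFun h0.1 k) i
        · exact congrFun h0.2 k
      rw [hZv] at hZ1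
      simp [hv0] at hZ1
    · have := congrFun (congrFun h1 i) j
      simp only [Finset.sum_apply, Finset.sum_sub_distrib, Pi.zero_apply, sub_eq_zero] at this
      exact this
  obtain ⟨f, u, v, hfu, huv, hfv⟩ := geometric_hahn_banach_compact_closed
    ((convex_spectraplex _).linear_image G) ((isCompact_spectraplex _).image hGc)
    ((convex_singleton 0).prod (convex_Ici 0)) (isClosed_singleton.prod isClosed_Ici) hdisj
  have hv0 : v < 0 := by
    have h0 := hfv 0 ⟨rfl, le_refl (0 : ℝ)⟩
    rwa [map_zero] at h0
  have hu0 : u < 0 := huv.trans hv0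
  set τ := f (0, 1) with hτ
  have hray : ∀ s : ℝ, 0 ≤ s → v < s * τ := by
    intro s hs
    have := hfv (0, s) ⟨rfl, hs⟩
    rw [clm_prod_eq_sum] at this
    simpa using this
  -- A linear function bounded below on a ray has nonnegative slope.
  have hτ0 : 0 ≤ τ := by
    by_contra! hneg
    have h1 := hray (v / τ) (div_nonneg_of_nonpos hv0.le hneg.le)
    rw [div_mul_cancel₀ _ hneg.ne] at h1
    exact lt_irrefl _ h1
  set P₀ : Matrix (Fin n) (Fin n) ℝ :=
    Matrix.of fun i j => f (Pi.single i (Pi.single j 1), 0) with hP₀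
  have hquad : ∀ y : Fin n → ℝ, ∑ i, ∑ j, f (Pi.single i (Pi.single j 1), 0) * (y i * y j) =
      y ⬝ᵥ (P₀ *ᵥ y) := by
    intro y
    simp only [P₀, dotProduct, Matrix.mulVec, Finset.mul_sum, Matrix.of_apply]
    exact Finset.sum_congr rfl fun i _ => Finset.sum_congr rfl fun j _ => by ring
  -- The bound f < u on the image of the spectraplex, applied to normalized rank-one moments and
  -- scaled back.
  have hineq : ∀ (x : Fin n → ℝ) (w : ℝ),
      (M *ᵥ x + w • B) ⬝ᵥ (P₀ *ᵥ (M *ᵥ x + w • B)) - x ⬝ᵥ (P₀ *ᵥ x) +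
        (δ ^ 2 * (K ⬝ᵥ x) ^ 2 - w ^ 2) * τ ≤ u * (x ⬝ᵥ x + w ^ 2) := by
    intro x w
    set z : Fin n ⊕ Unit → ℝ := Sum.elim x fun _ => w with hz
    have hzz : z ⬝ᵥ z = x ⬝ᵥ x + w ^ 2 := by
      simp [z, dotProduct, pow_two]
    have hxx : 0 ≤ x ⬝ᵥ x := by simpa using dotProduct_star_self_nonneg x
    have hfG : f (G fun a b => z a * z b) =
        (M *ᵥ x + w • B) ⬝ᵥ (P₀ *ᵥ (M *ᵥ x + w • B)) - x ⬝ᵥ (P₀ *ᵥ x) +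
        (δ ^ 2 * (K ⬝ᵥ x) ^ 2 - w ^ 2) * τ := by
      rw [hGdef, momentMap_rankOne, clm_prod_eq_sum]
      simp only [mul_sub, Finset.sum_sub_distrib, hquad]
      simp only [z, Sum.elim_comp_inl, Sum.elim_inr]
      rfl
    rw [← hfG, ← hzz]
    rcases (by rw [hzz]; positivity : 0 ≤ z ⬝ᵥ z).eq_or_lt with h0 | h0
    · have : z = 0 := dotProduct_self_eq_zero.1 h0.symm
      rw [this]
      simp only [Pi.zero_apply, mul_zero, dotProduct_zero]
      have h00 : (fun _ _ => 0 : (Fin n ⊕ Unit) → (Fin n ⊕ Unit) → ℝ) = 0 := rfl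
      rw [h00, map_zero, map_zero]
    · have h1 := hfu _ ⟨_, mem_spectraplex_rankOne h0, rfl⟩
      rw [map_smul, map_smul, smul_eq_mul, inv_mul_lt_iff₀ h0, mul_comm] at h1
      exact h1.le
  -- `P₀` need not be symmetric; its symmetric part has the same quadratic form.
  set P : Matrix (Fin n) (Fin n) ℝ := (1 / 2 : ℝ) • (P₀ + P₀ᵀ) with hP
  have hPP : ∀ y : Fin n → ℝ, y ⬝ᵥ (P *ᵥ y) = y ⬝ᵥ (P₀ *ᵥ y) := by
    intro y
    rw [hP, Matrix.smul_mulVec, Matrix.add_mulVec, dotProduct_smul, dotProduct_add,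
      Matrix.mulVec_transpose, dotProduct_comm y (y ᵥ* P₀), ← Matrix.dotProduct_mulVec, smul_eq_mul]
    ring
  have hxpos : ∀ x : Fin n → ℝ, x ≠ 0 → 0 < x ⬝ᵥ x := by
    intro x hx
    have h0 : 0 ≤ x ⬝ᵥ x := by simpa using dotProduct_star_self_nonneg x
    exact h0.lt_of_ne fun h => hx (dotProduct_self_eq_zero.1 h.symm)
  have hpos : ∀ x : Fin n → ℝ, x ≠ 0 → 0 < x ⬝ᵥ (P *ᵥ x) := by
    intro x hx
    refine hS.quadForm_pos (fun x hx => ?_) hx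
    have h1 := hineq x 0
    rw [zero_smul, add_zero] at h1
    rw [hPP, hPP]
    have h2 := mul_neg_of_neg_of_pos hu0 (hxpos x hx)
    have h3 : 0 ≤ δ ^ 2 * (K ⬝ᵥ x) ^ 2 * τ := by positivity
    nlinarith
  -- Inside the sector the supply term is nonnegative and can be dropped, leaving decay at rate -u >
  -- 0.
  refine ⟨P, ?_, -u, by linarith, fun x w hw => ?_⟩
  · refine Matrix.PosDef.of_dotProduct_mulVec_pos ?_ fun x hx => ?_
    · simp only [Matrix.IsHermitian, hP, Matrix.conjTranspose_eq_transpose_of_trivial,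
        Matrix.transpose_smul, Matrix.transpose_add, Matrix.transpose_transpose]
      rw [add_comm]
    · simpa using hpos x hx
  · rw [hPP, hPP]
    have h1 := hineq x w
    have h2 : w ^ 2 ≤ δ ^ 2 * (K ⬝ᵥ x) ^ 2 := by
      have := pow_le_pow_left₀ (abs_nonneg w) hw 2
      rwa [mul_pow, sq_abs, sq_abs] at this
    have h3 : 0 ≤ (δ ^ 2 * (K ⬝ᵥ x) ^ 2 - w ^ 2) * τ := mul_nonneg (by linarith) hτ0
    nlinarith [sq_nonneg w]

/-! ### The uncertainty set -/

/-- [I A] times the data block is [I, X_U - A X₋]: consistency means that the residual is an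
admissible noise. -/
theorem mem_uncertaintySet_iff {n T : ℕ} {B : Fin n → ℝ} {x : Fin (T + 1) → Fin n → ℝ}
    {u : Fin T → ℝ} {Φ₁₁ : Matrix (Fin n) (Fin n) ℝ} {Φ₁₂ : Matrix (Fin n) (Fin T) ℝ}
    {Φ₂₂ : Matrix (Fin T) (Fin T) ℝ} {A : Matrix (Fin n) (Fin n) ℝ} :
    A ∈ uncertaintySet B x u Φ₁₁ Φ₁₂ Φ₂₂ ↔
      NoiseBound Φ₁₁ Φ₁₂ Φ₂₂ (dataXU B x u - A * dataPast x) := by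
  have h : (Matrix.fromRows (1 : Matrix (Fin n) (Fin n) ℝ) Aᵀ)ᵀ * dataBlock B x u =
      (Matrix.fromRows (1 : Matrix (Fin n) (Fin n) ℝ) (dataXU B x u - A * dataPast x)ᵀ)ᵀ := by
    rw [Matrix.transpose_fromRows, Matrix.transpose_fromRows, dataBlock,
      Matrix.fromCols_mul_fromBlocks]
    simp [sub_eq_add_neg]
  have h' := congrArg Matrix.transpose h
  rw [Matrix.transpose_mul, Matrix.transpose_transpose, Matrix.transpose_transpose] at h'
  change Matrix.PosSemidef _ ↔ Matrix.PosSemidef _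
  rw [← Matrix.mul_assoc, ← Matrix.mul_assoc, h, Matrix.mul_assoc, h']

theorem noiseMatrix_eq {n T : ℕ} {B : Fin n → ℝ} {x : Fin (T + 1) → Fin n → ℝ}
    {u : Fin T → ℝ} {A₀ : Matrix (Fin n) (Fin n) ℝ} {w : Fin T → Fin n → ℝ}
    (hsys : ∀ k : Fin T, x k.succ = A₀ *ᵥ x k.castSucc + u k • B + w k) :
    dataXU B x u - A₀ * dataPast x = noiseMatrix w := by
  ext i k
  have := congrFun (hsys k) i
  simp only [Pi.add_apply, Pi.smul_apply, smul_eq_mul] at this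
  simp only [dataXU, dataFuture, dataPast, noiseMatrix, Matrix.sub_apply, Matrix.of_apply,
    Matrix.vecMulVec_apply, Matrix.mul_apply]
  rw [this, Matrix.mulVec, dotProduct]
  ring

/-! ### Compactness of the set of consistent systems -/

theorem exists_pos_mul_le_of_posDef {κ : Type*} [Fintype κ] {M : Matrix κ κ ℝ} (hM : M.PosDef) :
    ∃ c : ℝ, 0 < c ∧ ∀ v : κ → ℝ, c * (v ⬝ᵥ v) ≤ v ⬝ᵥ (M *ᵥ v) := by
  set S : Set (κ → ℝ) := {v | v ⬝ᵥ v = 1} with hS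
  have hScpt : IsCompact S := by
    refine (isCompact_univ_pi fun _ : κ => isCompact_Icc (a := (-1 : ℝ)) (b := 1)).of_isClosed_subset
      (isClosed_eq (by fun_prop) continuous_const) ?_
    intro v hv i _
    have h1 : v i * v i ≤ v ⬝ᵥ v :=
      Finset.single_le_sum (f := fun i => v i * v i) (fun i _ => mul_self_nonneg _)
        (Finset.mem_univ i)
    rw [show v ⬝ᵥ v = 1 from hv] at h1
    rw [Set.mem_Icc, ← abs_le]
    exact abs_le_one_iff_mul_self_le_one.2 h1
  have hnn : ∀ v : κ → ℝ, 0 ≤ v ⬝ᵥ v := fun v => by simpa using dotProduct_star_self_nonneg v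
  have key : ∀ v : κ → ℝ, v ≠ 0 → (√(v ⬝ᵥ v))⁻¹ • v ∈ S := by
    intro v hv
    have h0 : v ⬝ᵥ v ≠ 0 := fun h => hv (dotProduct_self_eq_zero.1 h)
    simp only [S, Set.mem_ofPred_eq, smul_dotProduct, dotProduct_smul, smul_eq_mul]
    rw [← mul_assoc, ← mul_inv, Real.mul_self_sqrt (hnn v), inv_mul_cancel₀ h0]
  rcases S.eq_empty_or_nonempty with hemp | hne
  · refine ⟨1, one_pos, fun v => ?_⟩
    by_cases hv : v = 0
    · simp [hv]
    · exact absurd (key v hv) (by simp [hemp])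
  · obtain ⟨v₀, hv₀, hmin⟩ := hScpt.exists_isMinOn hne
      (f := fun v => v ⬝ᵥ (M *ᵥ v)) (by fun_prop)
    have hv₀0 : v₀ ≠ 0 := by
      rintro rfl
      simp [S] at hv₀
    refine ⟨v₀ ⬝ᵥ (M *ᵥ v₀), by simpa using hM.dotProduct_mulVec_pos hv₀0, fun v => ?_⟩
    by_cases hv : v = 0
    · simp [hv]
    have h1 : v₀ ⬝ᵥ (M *ᵥ v₀) ≤ _ := hmin (key v hv)
    simp only [Matrix.mulVec_smul, smul_dotProduct, dotProduct_smul, smul_eq_mul] at h1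
    have h0 : 0 < v ⬝ᵥ v := (hnn v).lt_of_ne fun h => hv (dotProduct_self_eq_zero.1 h.symm)
    rwa [← mul_assoc, ← mul_inv, Real.mul_self_sqrt (hnn v), inv_mul_eq_div, le_div_iff₀ h0] at h1

theorem noiseBound_diag {n T : ℕ} {Φ₁₁ : Matrix (Fin n) (Fin n) ℝ}
    {Φ₁₂ : Matrix (Fin n) (Fin T) ℝ} {Φ₂₂ : Matrix (Fin T) (Fin T) ℝ}
    {Y : Matrix (Fin n) (Fin T) ℝ} (h : NoiseBound Φ₁₁ Φ₁₂ Φ₂₂ Y) (i : Fin n) :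
    0 ≤ Φ₁₁ i i + 2 * (Φ₁₂ i ⬝ᵥ Y i) + Y i ⬝ᵥ (Φ₂₂ *ᵥ Y i) := by
  have h1 := Matrix.PosSemidef.diag_nonneg h (i := i)
  rw [Matrix.transpose_fromRows, Matrix.fromCols_mul_fromBlocks, Matrix.fromCols_mul_fromRows] at h1
  simp only [Matrix.transpose_one, Matrix.one_mul, Matrix.transpose_transpose, Matrix.mul_one,
    Matrix.add_apply, Matrix.add_mul] at h1
  have e1 : (Y * Φ₁₂ᵀ) i i = Φ₁₂ i ⬝ᵥ Y i := by
    rw [dotProduct_comm]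
    rfl
  have e2 : (Φ₁₂ * Yᵀ) i i = Φ₁₂ i ⬝ᵥ Y i := rfl
  have e3 : (Y * Φ₂₂ * Yᵀ) i i = Y i ⬝ᵥ (Φ₂₂ *ᵥ Y i) := by
    rw [Matrix.mul_assoc]
    rfl
  rw [e1, e2, e3] at h1
  linarith

theorem isClosed_noiseBound {n T : ℕ} (Φ₁₁ : Matrix (Fin n) (Fin n) ℝ)
    (Φ₁₂ : Matrix (Fin n) (Fin T) ℝ) (Φ₂₂ : Matrix (Fin T) (Fin T) ℝ) :
    IsClosed {Y | NoiseBound Φ₁₁ Φ₁₂ Φ₂₂ Y} := by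
  refine (isClosed_setOf_posSemidef (Fin n)).preimage
    (f := fun Y : Matrix (Fin n) (Fin T) ℝ => (Matrix.fromRows (1 : Matrix (Fin n) (Fin n) ℝ) Yᵀ)ᵀ *
    Matrix.fromBlocks Φ₁₁ Φ₁₂ Φ₁₂ᵀ Φ₂₂ * Matrix.fromRows (1 : Matrix (Fin n) (Fin n) ℝ) Yᵀ) ?_
  have : Continuous fun Y : Matrix (Fin n) (Fin T) ℝ =>
      Matrix.fromRows (1 : Matrix (Fin n) (Fin n) ℝ) Yᵀ := by
    refine continuous_matrix fun a b => ?_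
    rcases a with a | a
    · exact continuous_const
    · exact continuous_id.matrix_elem b a
  fun_prop

theorem isCompact_noiseBound {n T : ℕ} (Φ₁₁ : Matrix (Fin n) (Fin n) ℝ)
    (Φ₁₂ : Matrix (Fin n) (Fin T) ℝ) {Φ₂₂ : Matrix (Fin T) (Fin T) ℝ} (hΦ₂₂ : (-Φ₂₂).PosDef) :
    IsCompact {Y | NoiseBound Φ₁₁ Φ₁₂ Φ₂₂ Y} := by
  obtain ⟨c, hc, hcb⟩ := exists_pos_mul_le_of_posDef hΦ₂₂
  -- From c|Y i|² ≤ Φ₁₁ i i + 2 Φ₁₂ i · Y i, absorbing the cross term by 2 Φ₁₂ i · Y i ≤ (2/c)|Φ₁₂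
  -- i|² + (c/2)|Y i|².
  set r : Fin n → ℝ := fun i => 2 / c * (Φ₁₁ i i + 2 / c * (Φ₁₂ i ⬝ᵥ Φ₁₂ i)) with hr
  have hK : IsCompact (Set.univ.pi fun i : Fin n => Set.univ.pi fun _ : Fin T =>
      Set.Icc (-√(r i)) (√(r i))) :=
    isCompact_univ_pi fun _ => isCompact_univ_pi fun _ => isCompact_Icc
  refine hK.of_isClosed_subset (isClosed_noiseBound Φ₁₁ Φ₁₂ Φ₂₂) ?_
  intro Y hY i _ k _
  have h1 := noiseBound_diag hY i
  have h2 := hcb (Y i)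
  rw [Matrix.neg_mulVec, dotProduct_neg] at h2
  have h3 : 0 ≤ ((2 / c) • Φ₁₂ i - Y i) ⬝ᵥ ((2 / c) • Φ₁₂ i - Y i) := by
    simpa using dotProduct_star_self_nonneg ((2 / c) • Φ₁₂ i - Y i)
  simp only [dotProduct_sub, sub_dotProduct, smul_dotProduct, dotProduct_smul, smul_eq_mul] at h3
  rw [dotProduct_comm (Y i) (Φ₁₂ i)] at h3
  have h4 : Y i k * Y i k ≤ Y i ⬝ᵥ Y i :=
    Finset.single_le_sum (f := fun k => Y i k * Y i k) (fun i _ => mul_self_nonneg _)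
      (Finset.mem_univ k)
  have h5 : Y i ⬝ᵥ Y i ≤ r i := by
    have h6 : c / 2 * (Y i ⬝ᵥ Y i) ≤ Φ₁₁ i i + 2 / c * (Φ₁₂ i ⬝ᵥ Φ₁₂ i) := by
      have h7 := mul_le_mul_of_nonneg_left h3 (by positivity : 0 ≤ c / 2)
      have h8 : c / 2 * (2 / c * (2 / c * (Φ₁₂ i ⬝ᵥ Φ₁₂ i) - (Φ₁₂ i ⬝ᵥ Y i)) -
          (2 / c * (Φ₁₂ i ⬝ᵥ Y i) - Y i ⬝ᵥ Y i)) =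
          2 / c * (Φ₁₂ i ⬝ᵥ Φ₁₂ i) - 2 * (Φ₁₂ i ⬝ᵥ Y i) + c / 2 * (Y i ⬝ᵥ Y i) := by
        field_simp
        ring
      rw [mul_zero, h8] at h7
      linarith
    have h9 := mul_le_mul_of_nonneg_left h6 (by positivity : 0 ≤ 2 / c)
    calc Y i ⬝ᵥ Y i = 2 / c * (c / 2 * (Y i ⬝ᵥ Y i)) := by field_simp
      _ ≤ r i := h9
  rw [Set.mem_Icc, ← abs_le]
  apply Real.abs_le_sqrt
  rw [pow_two]
  exact h4.trans h5

theorem exists_right_inverse_of_vecMul {n T : ℕ} {X : Matrix (Fin n) (Fin T) ℝ}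
    (h : ∀ v : Fin n → ℝ, v ᵥ* X = 0 → v = 0) : ∃ R : Matrix (Fin T) (Fin n) ℝ, X * R = 1 := by
  have hdet : IsUnit (X * Xᵀ).det := by
    rw [isUnit_iff_ne_zero]
    intro h0
    obtain ⟨v, hv, hv0⟩ := Matrix.exists_mulVec_eq_zero_iff.2 h0
    refine hv (h v ?_)
    have h1 : v ⬝ᵥ ((X * Xᵀ) *ᵥ v) = 0 := by rw [hv0, dotProduct_zero]
    rw [← Matrix.mulVec_mulVec, Matrix.dotProduct_mulVec, Matrix.mulVec_transpose] at h1
    exact dotProduct_self_eq_zero.1 h1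
  exact ⟨Xᵀ * (X * Xᵀ)⁻¹, by rw [← Matrix.mul_assoc, Matrix.mul_nonsing_inv _ hdet]⟩

theorem IsSchur.abs_trace_le {n : ℕ} {M : Matrix (Fin n) (Fin n) ℝ} (h : IsSchur M) :
    |M.trace| ≤ n := by
  have h1 : ‖(M.map Complex.ofReal).trace‖ = |M.trace| := by
    rw [← Real.norm_eq_abs, ← Complex.norm_real]
    simp [Matrix.trace]
  rw [← h1, Matrix.trace_eq_sum_roots_charpoly]
  set s := (M.map Complex.ofReal).charpoly.roots with hs
  have h2 : ∀ t ∈ s.map norm, t ≤ (1 : ℝ) := by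
    intro t ht
    obtain ⟨z, hz, rfl⟩ := Multiset.mem_map.1 ht
    refine (h z ?_).le
    rw [Matrix.mem_spectrum_iff_isRoot_charpoly]
    exact Polynomial.isRoot_of_mem_roots hz
  have h3 : s.card ≤ n := by
    refine (Polynomial.card_roots' _).trans ?_
    rw [Matrix.charpoly_natDegree_eq_dim, Fintype.card_fin]
  calc ‖s.sum‖ ≤ (s.map norm).sum := norm_multiset_sum_le s
    _ ≤ (s.map norm).card • (1 : ℝ) := Multiset.sum_le_card_nsmul _ _ h2
    _ ≤ n := by
      rw [Multiset.card_map, nsmul_eq_mul, mul_one]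
      exact_mod_cast h3

/-- If one gain stabilizes all consistent systems, the consistent systems form a compact set. -/
theorem isCompact_uncertaintySet {n T : ℕ} {B : Fin n → ℝ} {x : Fin (T + 1) → Fin n → ℝ}
    {u : Fin T → ℝ} {Φ₁₁ : Matrix (Fin n) (Fin n) ℝ} {Φ₁₂ : Matrix (Fin n) (Fin T) ℝ}
    {Φ₂₂ : Matrix (Fin T) (Fin T) ℝ} (hΦ₂₂ : (-Φ₂₂).PosDef)
    (hne : (uncertaintySet B x u Φ₁₁ Φ₁₂ Φ₂₂).Nonempty) {K : Fin n → ℝ}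
    (hK : ∀ A ∈ uncertaintySet B x u Φ₁₁ Φ₁₂ Φ₂₂, IsSchur (closedLoop A B K)) :
    IsCompact (uncertaintySet B x u Φ₁₁ Φ₁₂ Φ₂₂) := by
  obtain ⟨A₀, hA₀⟩ := hne
  have hinj : ∀ v : Fin n → ℝ, v ᵥ* dataPast x = 0 → v = 0 := by
    intro v hv
    by_contra hv0
    have hvv : v ⬝ᵥ v ≠ 0 := fun h => hv0 (dotProduct_self_eq_zero.1 h)
    -- If vᵀX₋ = 0, adding multiples of vvᵀ to A₀ stays in Σ; this t makes the closed-loop trace n +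
    -- 1, too large for a Schur matrix.
    set t : ℝ := (n + 1 - (closedLoop A₀ B K).trace) / (v ⬝ᵥ v) with ht
    have hmem : A₀ + t • Matrix.vecMulVec v v ∈ uncertaintySet B x u Φ₁₁ Φ₁₂ Φ₂₂ := by
      rw [mem_uncertaintySet_iff] at hA₀ ⊢
      have h0 : Matrix.vecMulVec v v * dataPast x = 0 := by
        rw [Matrix.vecMulVec_mul, hv]
        ext i j
        simp [Matrix.vecMulVec_apply]
      rwa [Matrix.add_mul, Matrix.smul_mul, h0, smul_zero, add_zero]
    have h1 := (hK _ hmem).abs_trace_le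
    have h2 : (closedLoop (A₀ + t • Matrix.vecMulVec v v) B K).trace = n + 1 := by
      have h3 : closedLoop (A₀ + t • Matrix.vecMulVec v v) B K =
          closedLoop A₀ B K + t • Matrix.vecMulVec v v := by
        rw [closedLoop, closedLoop]
        abel
      rw [h3, Matrix.trace_add, Matrix.trace_smul, Matrix.trace_vecMulVec, smul_eq_mul, ht,
        div_mul_cancel₀ _ hvv]
      ring
    rw [h2] at h1
    have h4 := (le_abs_self _).trans h1
    linarith
  obtain ⟨R, hR⟩ := exists_right_inverse_of_vecMul hinj
  -- A right inverse R of X₋ recovers A = (X_U - Y)R from the residual Y, so Σ lies in a continuous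
  -- image of the compact noise set.
  have hc : Continuous fun Y : Matrix (Fin n) (Fin T) ℝ => (dataXU B x u - Y) * R := by fun_prop
  refine ((isCompact_noiseBound Φ₁₁ Φ₁₂ hΦ₂₂).image hc).of_isClosed_subset ?_ ?_
  · have : uncertaintySet B x u Φ₁₁ Φ₁₂ Φ₂₂ =
        (fun A => dataXU B x u - A * dataPast x) ⁻¹' {Y | NoiseBound Φ₁₁ Φ₁₂ Φ₂₂ Y} :=
      Set.ext fun A => mem_uncertaintySet_iff
    rw [this]
    exact (isClosed_noiseBound Φ₁₁ Φ₁₂ Φ₂₂).preimage (by fun_prop)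
  · intro A hA
    refine ⟨_, mem_uncertaintySet_iff.1 hA, ?_⟩
    simp only [sub_sub_cancel]
    rw [Matrix.mul_assoc, hR, Matrix.mul_one]

/-! ### The worst-case norm -/

theorem continuousOn_transferFn {n : ℕ} {S : Set (Matrix (Fin n) (Fin n) ℝ)} {B K : Fin n → ℝ}
    (hS : ∀ A ∈ S, IsSchur (closedLoop A B K)) :
    ContinuousOn (fun p : Matrix (Fin n) (Fin n) ℝ × ℂ => transferFn p.1 B K p.2)
      (S ×ˢ Metric.sphere (0 : ℂ) 1) := by
  set N : Matrix (Fin n) (Fin n) ℝ × ℂ → Matrix (Fin n) (Fin n) ℂ := fun p =>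
    p.2 • (1 : Matrix (Fin n) (Fin n) ℂ) - (closedLoop p.1 B K).map Complex.ofReal with hN
  have hNc : Continuous N := by
    have h1 : Continuous fun p : Matrix (Fin n) (Fin n) ℝ × ℂ =>
        (closedLoop p.1 B K).map Complex.ofReal := by
      refine Continuous.matrix_map ?_ Complex.continuous_ofReal
      unfold closedLoop
      fun_prop
    exact (continuous_snd.smul continuous_const).sub h1
  have hinv : ContinuousOn (fun p => (N p).det⁻¹ • (N p).adjugate)
      (S ×ˢ Metric.sphere (0 : ℂ) 1) := by
    refine ContinuousOn.smul (hNc.matrix_det.continuousOn.inv₀ ?_) hNc.matrix_adjugate.continuousOn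
    rintro ⟨A, z⟩ ⟨hA, hz⟩
    exact ((hS A hA).isUnit_det (by simpa using hz)).ne_zero
  have heq : (fun p : Matrix (Fin n) (Fin n) ℝ × ℂ => transferFn p.1 B K p.2) = fun p =>
      (fun i => (K i : ℂ)) ⬝ᵥ (((N p).det⁻¹ • (N p).adjugate) *ᵥ fun i => (B i : ℂ)) := by
    ext p
    rw [transferFn, Matrix.inv_def, Ring.inverse_eq_inv']
  rw [heq]
  have hlin : Continuous fun L : Matrix (Fin n) (Fin n) ℂ =>
      (fun i => (K i : ℂ)) ⬝ᵥ (L *ᵥ fun i => (B i : ℂ)) := by fun_prop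
  exact hlin.comp_continuousOn hinv

theorem isSchur_of_hInfNorm_lt_top {n : ℕ} {A : Matrix (Fin n) (Fin n) ℝ} {B K : Fin n → ℝ}
    (h : hInfNorm A B K < ∞) : IsSchur (closedLoop A B K) := by
  by_contra hS
  rw [hInfNorm, if_neg hS] at h
  exact lt_irrefl _ h

theorem sectorStable_of_hInfNorm_lt {n : ℕ} {A : Matrix (Fin n) (Fin n) ℝ} {B K : Fin n → ℝ}
    {δ : ℝ} (hδ : 0 < δ) (h : hInfNorm A B K < ENNReal.ofReal δ⁻¹) :
    SectorStable (closedLoop A B K) B K δ := by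
  have hS := isSchur_of_hInfNorm_lt_top (h.trans ENNReal.ofReal_lt_top)
  refine sectorStable_of_norm_transferFn_lt hδ.le hS fun z hz => ?_
  rw [hInfNorm, if_pos hS] at h
  have h1 : ‖transferFn A B K z‖ₑ < ENNReal.ofReal δ⁻¹ :=
    (le_iSup₂ (f := fun (z : ℂ) (_ : ‖z‖ = 1) => ‖transferFn A B K z‖ₑ) z hz).trans_lt h
  rw [← ofReal_norm, ENNReal.ofReal_lt_ofReal_iff (inv_pos.2 hδ)] at h1
  rwa [← lt_inv_mul_iff₀ hδ, mul_one]

/-- On a compact set of systems the worst-case norm is attained. -/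
theorem worstNorm_lt_of_sectorStable {n : ℕ} {S : Set (Matrix (Fin n) (Fin n) ℝ)}
    (hScpt : IsCompact S) (hne : S.Nonempty) {B K : Fin n → ℝ} {δ : ℝ} (hδ : 0 < δ)
    (h : ∀ A ∈ S, SectorStable (closedLoop A B K) B K δ) :
    worstNorm S B K < ENNReal.ofReal δ⁻¹ := by
  have hS : ∀ A ∈ S, IsSchur (closedLoop A B K) := fun A hA => (h A hA).isSchur hδ.le
  -- Maximizing jointly over plant and frequency keeps the pointwise strict inequality strict for
  -- the supremum.
  obtain ⟨⟨A₁, z₁⟩, ⟨hA₁, hz₁⟩, hmax⟩ :=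
    (hScpt.prod (isCompact_sphere (0 : ℂ) 1)).exists_isMaxOn
      (hne.prod (NormedSpace.sphere_nonempty.2 zero_le_one)) (continuousOn_transferFn hS).norm
  have hlt : ‖transferFn A₁ B K z₁‖ < δ⁻¹ := by
    have h1 := (h A₁ hA₁).norm_transferFn_lt hδ (by simpa using hz₁)
    rwa [← lt_inv_mul_iff₀ hδ, mul_one] at h1
  refine lt_of_le_of_lt ?_ ((ENNReal.ofReal_lt_ofReal_iff (inv_pos.2 hδ)).2 hlt)
  refine iSup₂_le fun A hA => ?_
  rw [hInfNorm, if_pos (hS A hA)]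
  refine iSup₂_le fun z hz => ?_
  rw [← ofReal_norm]
  exact ENNReal.ofReal_le_ofReal (hmax (a := (A, z)) ⟨hA, by simpa using hz⟩)

end QuantizedStabilization

end

theorem theorem2 {n T : ℕ} (B : Fin n → ℝ)
    (x : Fin (T + 1) → Fin n → ℝ) (u : Fin T → ℝ)
    (Φ₁₁ : Matrix (Fin n) (Fin n) ℝ) (Φ₁₂ : Matrix (Fin n) (Fin T) ℝ)
    (Φ₂₂ : Matrix (Fin T) (Fin T) ℝ)
    (hΦ₁₁ : Φ₁₁.IsSymm) (hΦ₂₂ : (-Φ₂₂).PosDef)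
    (A₀ : Matrix (Fin n) (Fin n) ℝ) (w : Fin T → Fin n → ℝ)
    (hsys : ∀ k : Fin T, x k.succ = A₀ *ᵥ x k.castSucc + u k • B + w k)
    (hnoise : QuantizedStabilization.NoiseBound Φ₁₁ Φ₁₂ Φ₂₂
      (QuantizedStabilization.noiseMatrix w))
    (hfeas : QuantizedStabilization.MinMaxFeasible
      (QuantizedStabilization.uncertaintySet B x u Φ₁₁ Φ₁₂ Φ₂₂) B)
    (u₀ : ℝ) (hu₀ : 0 < u₀) (δ : ℝ) (hδ₀ : 0 < δ) (hδ₁ : δ < 1) :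
    (∃ K : Fin n → ℝ,
      ∀ A ∈ QuantizedStabilization.uncertaintySet B x u Φ₁₁ Φ₁₂ Φ₂₂,
        QuantizedStabilization.Stabilizes A B K ((1 - δ) / (1 + δ)) u₀) ↔
    ENNReal.ofReal δ <
      1 / QuantizedStabilization.optValue
        (QuantizedStabilization.uncertaintySet B x u Φ₁₁ Φ₁₂ Φ₂₂) B := by
  open QuantizedStabilization in
  -- The goal becomes γ* < δ⁻¹ in the extended reals, which includes γ* = 0.
  rw [one_div, ENNReal.lt_inv_iff_lt_inv, ← ENNReal.ofReal_inv_of_pos hδ₀]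
  simp only [stabilizes_iff_sectorStable _ _ _ hδ₀ hδ₁ hu₀]
  constructor
  · rintro ⟨K, hK⟩
    have hne : (uncertaintySet B x u Φ₁₁ Φ₁₂ Φ₂₂).Nonempty :=
      ⟨A₀, mem_uncertaintySet_iff.2 (by rwa [noiseMatrix_eq hsys])⟩
    obtain ⟨K', hK'⟩ := hfeas
    have hcpt := isCompact_uncertaintySet hΦ₂₂ hne (K := K') fun A hA =>
      isSchur_of_hInfNorm_lt_top ((le_iSup₂ (f := fun A (_ : A ∈ uncertaintySet B x u Φ₁₁ Φ₁₂ Φ₂₂) =>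
        hInfNorm A B K') A hA).trans_lt hK')
    exact (iInf_le _ K).trans_lt (worstNorm_lt_of_sectorStable hcpt hne hδ₀ hK)
  · intro h
    obtain ⟨K, hK⟩ := iInf_lt_iff.1 h
    exact ⟨K, fun A hA => sectorStable_of_hInfNorm_lt hδ₀
      ((le_iSup₂ (f := fun A (_ : A ∈ uncertaintySet B x u Φ₁₁ Φ₁₂ Φ₂₂) =>
        hInfNorm A B K) A hA).trans_lt hK)⟩
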